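/- Let $n\ge 3$. For a nonincreasing sequence $\pi=(d_0,\dots,d_{n-1})$ of positive integers, let $\mathcal T_\pi$ be the set of all trees on $n$ vertices with degree sequence $\pi$; call $\pi$ a tree degree sequence if $\mathcal T_\pi\neq\emptyset$. For such $\pi$ let $T^*_\pi\in\mathcal T_\pi$ be the tree built by breadth-first search: its vertices are $v_0,\dots,v_{n-1}$, with $v_i$ of degree $d_i$; the root $v_0$ has children $v_1,\dots,v_{d_0}$; and then, for $i=1,2,\dots$ in order, the next $d_i-1$ vertices not yet used are the children of $v_i$. For a tree $T$ let $\varphi(T)$ be the number of nonempty subtrees of $T$, that is, of subgraphs of $T$ that are trees. For nonincreasing sequences $\pi=(d_0,\dots,d_{n-1})$ and $\pi_1=(d_0',\dots,d_{n-1}')$ write $\pi\triangleleft\pi_1$ if $\sum_{i=0}^k d_i\le\sum_{i=0}^k d_i'$ for $k=0,\dots,n-2$ and $\sum_{i=0}^{n-1} d_i=\sum_{i=0}^{n-1} d_i'$. **Theorem.** Let $\pi$ and $\pi_1$ be distinct tree degree sequences of length $n$ with $\pi\triangleleft\pi_1$. Then $\varphi(T^*_\pi)<\varphi(T^*_{\pi_1})$.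 Moreover, $\max_{T\in\mathcal T_\pi}\varphi(T)<\max_{T\in\mathcal T_{\pi_1}}\varphi(T)$. -/

import Mathlib

/-- The nonincreasing sequence `d` lists the degrees of the vertices of `G`
(each vertex being listed exactly once). -/
def HasDegreeSequence {n : ℕ} {V : Type*} (G : SimpleGraph V) (d : Fin n → ℕ) : Prop :=
  Antitone d ∧ ∃ e : Fin n ≃ V, ∀ i, (G.neighborSet (e i)).ncard = d i

/-- The set of all trees with degree sequence `d`. Such a tree has `n` vertices, so up to
isomorphism it is a graph on `Fin n`. -/
def treesWithDegrees {n : ℕ} (d : Fin n → ℕ) : Set (SimpleGraph (Fin n)) :=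
  {T | T.IsTree ∧ HasDegreeSequence T d}

/-- `d` is the (nonincreasing) degree sequence of some tree. -/
def IsTreeDegreeSequence {n : ℕ} (d : Fin n → ℕ) : Prop :=
  (treesWithDegrees d).Nonempty

/-- `d'` majorizes `d`: every partial sum of `d` is at most that of `d'`, and the total sums
agree. (Used for nonincreasing sequences of equal length.) -/
def Majorizes {n : ℕ} (d' d : Fin n → ℕ) : Prop :=
  (∀ k : Fin n, ∑ i ∈ Finset.Iic k, d i ≤ ∑ i ∈ Finset.Iic k, d' i) ∧
    ∑ i, d i = ∑ i, d' i

/-- The number of children of vertex `i` in the breadth-first tree: all `d 0` neighbours for the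
root `0`, and all neighbours except the parent for the other vertices. -/
def numChildren {n : ℕ} (d : Fin n → ℕ) (i : Fin n) : ℕ :=
  if (i : ℕ) = 0 then d i else d i - 1

/-- In the breadth-first construction the vertices are labelled `0, 1, …, n - 1` in the order in
which they are created (layer by layer, from left to right), and vertex `i` gets degree `d i`.
The vertices are processed in the same order, so the children of `i` are the next
`numChildren d i` labels after the root and all children of the vertices before `i`. -/
def IsBFSChild {n : ℕ} (d : Fin n → ℕ) (i j : Fin n) : Prop :=
  1 + ∑ l ∈ Finset.Iio i, numChildren d l ≤ (j : ℕ) ∧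
    (j : ℕ) < 1 + ∑ l ∈ Finset.Iic i, numChildren d l

/-- The tree obtained from the degree sequence `d` by breadth-first search: two distinct vertices
are adjacent when one of them is a child of the other. -/
def bfsTree {n : ℕ} (d : Fin n → ℕ) : SimpleGraph (Fin n) :=
  SimpleGraph.fromRel (IsBFSChild d)

/-- The number of (nonempty) subtrees of `G`, that is, of subgraphs of `G` that are trees. -/
noncomputable def subtreeCount {V : Type*} (G : SimpleGraph V) : ℕ :=
  {H : G.Subgraph | H.coe.IsTree}.ncard

/-! In a tree, subtrees correspond to connected vertex sets; write f(v) for the number of them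
containing v. For a tree degree sequence d, the right class to maximize over is not the trees with
degrees d but `treeClass d`, all trees whose degrees are majorized by d. Majorization is imposed on
arbitrary vertex subsets, so degrees need not be re-sorted after a modification of the tree; the
total sums agree automatically for trees.

Every maximizer in this class is a relabelling of `bfsTree d` with degree sequence d
(`bfsTree_of_maximal`). Three facts give this. Exchanging two branches keeps all degrees, so it
cannot increase the count; hence the f-order of two vertices is inherited by their children
(`exists_switch`), and a breadth-first listing exists along which f is nonincreasing
(`exists_bfs_key`). Moving a branch from v to a vertex u with f(v) ≤ f(u) strictly increases the
count (`exists_move`), so larger f forces larger degree (`vdeg_le_of_connCount_le`). Finally, if the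
degrees were strictly majorized by d, one such move would still stay in the class
(`exists_transfer`), so they equal d (`vdeg_eq_of_maximal`).

If π is majorized by π₁, the classes are nested. Were the maxima equal, a maximizer for π would also
be one for π₁ and would have both degree sequences, forcing π = π₁. The same maxima are attained on
the trees with exactly the given degrees, so both claims follow. -/

/-- `S` is nonempty and every nontrivial cut of `S` is crossed by an edge. -/
def ConnectedOn {V : Type*} (G : SimpleGraph V) (S : Finset V) : Prop :=
  S.Nonempty ∧ ∀ X ⊆ S, X.Nonempty → X ≠ S → ∃ a ∈ X, ∃ b ∈ S, b ∉ X ∧ G.Adj a b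

open Classical in
/-- The connected vertex sets of `G` containing `A`. -/
noncomputable def connSets {V : Type*} [Fintype V] (G : SimpleGraph V) (A : Finset V) :
    Finset (Finset V) :=
  Finset.univ.filter fun S : Finset V => ConnectedOn G S ∧ A ⊆ S

theorem mem_connSets {V : Type*} [Fintype V] {G : SimpleGraph V} {A S : Finset V} :
    S ∈ connSets G A ↔ ConnectedOn G S ∧ A ⊆ S := by
  simp [connSets]

/-- The number of connected vertex sets of `G` containing `A`. -/
noncomputable def connCount {V : Type*} [Fintype V] (G : SimpleGraph V) (A : Finset V) : ℕ :=
  (connSets G A).card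

/-! ### Connectivity by cuts, and the effect of one edge. -/

namespace ConnectedOn

variable {V : Type*} {G H : SimpleGraph V} {S X : Finset V}

theorem mono (hS : ConnectedOn G S) (h : G ≤ H) : ConnectedOn H S :=
  ⟨hS.1, fun X hX hne hneS => by
    obtain ⟨a, ha, b, hb, hbX, hab⟩ := hS.2 X hX hne hneS
    exact ⟨a, ha, b, hb, hbX, h hab⟩⟩

theorem singleton (v : V) : ConnectedOn G {v} := by
  refine ⟨Finset.singleton_nonempty v, fun X hX hne hneS => ?_⟩
  exact absurd ((Finset.Nonempty.subset_singleton_iff hne).1 hX) hneS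

theorem reachable (hS : ConnectedOn G S) {a b : V} (ha : a ∈ S) (hb : b ∈ S) :
    G.Reachable a b := by
  classical
  by_contra hab
  obtain ⟨x, hx, y, hy, hyX, hxy⟩ := hS.2 (S.filter fun v => G.Reachable a v)
    (Finset.filter_subset _ _) ⟨a, by simp [ha]⟩ (fun h => hab (by
      rw [← h] at hb; exact (Finset.mem_filter.1 hb).2))
  exact hyX (Finset.mem_filter.2 ⟨hy, (Finset.mem_filter.1 hx).2.trans hxy.reachable⟩)

theorem union_edge [DecidableEq V] {S₁ S₂ : Finset V} {x y : V} (h₁ : ConnectedOn H S₁) (h₂ : ConnectedOn H S₂)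
    (hx : x ∈ S₁) (hy : y ∈ S₂) (hxy : x ≠ y) :
    ConnectedOn (H ⊔ SimpleGraph.edge x y) (S₁ ∪ S₂) := by
  refine ⟨⟨x, by simp [hx]⟩, fun X hX hne hneS => ?_⟩
  -- A connected piece either yields a crossing edge or lies entirely on one side of X; if neither
  -- piece yields one, they lie on opposite sides and xy crosses.
  have key : ∀ S : Finset V, S ⊆ S₁ ∪ S₂ → ConnectedOn H S →
      (∃ a ∈ X, ∃ b ∈ S₁ ∪ S₂, b ∉ X ∧ (H ⊔ SimpleGraph.edge x y).Adj a b) ∨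
        S ⊆ X ∨ ∀ v ∈ S, v ∉ X := by
    intro S hS hc
    by_cases h1 : (X ∩ S).Nonempty
    · by_cases h2 : X ∩ S = S
      · exact Or.inr (Or.inl (Finset.inter_eq_right.1 h2))
      · obtain ⟨a, ha, b, hb, hbX, hab⟩ := hc.2 _ Finset.inter_subset_right h1 h2
        refine Or.inl ⟨a, (Finset.mem_inter.1 ha).1, b, hS hb, fun h => hbX ?_, Or.inl hab⟩
        exact Finset.mem_inter.2 ⟨h, hb⟩
    · refine Or.inr (Or.inr fun v hv hvX => h1 ⟨v, Finset.mem_inter.2 ⟨hvX, hv⟩⟩)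
  rcases key S₁ Finset.subset_union_left h₁ with h | h1
  · exact h
  rcases key S₂ Finset.subset_union_right h₂ with h | h2
  · exact h
  rcases h1 with h1 | h1 <;> rcases h2 with h2 | h2
  · exact absurd (Finset.Subset.antisymm hX (Finset.union_subset h1 h2)) hneS
  · refine ⟨x, h1 hx, y, by simp [hy], h2 y hy, ?_⟩
    simp [SimpleGraph.edge_adj, hxy]
  · refine ⟨y, h2 hy, x, by simp [hx], h1 x hx, ?_⟩
    simp [SimpleGraph.edge_adj, hxy, hxy.symm]
  · obtain ⟨v, hv⟩ := hne
    rcases Finset.mem_union.1 (hX hv) with h | h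
    · exact absurd hv (h1 v h)
    · exact absurd hv (h2 v h)

/-- One side of a cut crossed only by the edge `xy` stays connected when `xy` is removed. -/
theorem of_cut {x y : V} (hS : ConnectedOn (H ⊔ SimpleGraph.edge x y) S) (hX : X ⊆ S)
    (hxX : x ∈ X) (hyX : y ∉ X) (hcut : ∀ a ∈ X, ∀ b ∈ S, b ∉ X → ¬H.Adj a b) :
    ConnectedOn H X := by
  classical
  refine ⟨⟨x, hxX⟩, fun Y hY hne hneX => ?_⟩
  -- For W avoiding x, an edge leaving W is neither xy nor an edge leaving X. Since cuts are
  -- symmetric, it suffices to treat whichever of Y and its complement in X avoids x.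
  have key : ∀ W ⊆ X, W.Nonempty → x ∉ W → ∃ a ∈ W, ∃ b ∈ X, b ∉ W ∧ H.Adj a b := by
    intro W hW hWne hxW
    obtain ⟨a, ha, b, hb, hbW, hab⟩ := hS.2 W (hW.trans hX) hWne
      (fun h => hxW (h ▸ hX hxX))
    have hab' : H.Adj a b := by
      rcases hab with h | h
      · exact h
      · rw [SimpleGraph.edge_adj] at h
        rcases h.1 with ⟨h1, -⟩ | ⟨h1, -⟩
        · exact absurd (h1 ▸ ha) hxW
        · exact absurd (hW (h1 ▸ ha)) hyX
    refine ⟨a, ha, b, ?_, hbW, hab'⟩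
    by_contra hbX
    exact hcut a (hW ha) b hb hbX hab'
  by_cases hxY : x ∈ Y
  · obtain ⟨a, ha, b, hb, hbW, hab⟩ := key (X \ Y) Finset.sdiff_subset
      (Finset.sdiff_nonempty.2 fun h => hneX (Finset.Subset.antisymm hY h)) (by simp [hxY])
    refine ⟨b, ?_, a, (Finset.mem_sdiff.1 ha).1, (Finset.mem_sdiff.1 ha).2, hab.symm⟩
    by_contra hbY
    exact hbW (Finset.mem_sdiff.2 ⟨hb, hbY⟩)
  · exact key Y hY hne hxY

theorem edge_cases {x y : V} (hS : ConnectedOn (H ⊔ SimpleGraph.edge x y) S)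
    (hnot : ¬ConnectedOn H S) :
    ∃ X ⊆ S, x ∈ X ∧ y ∈ S ∧ y ∉ X ∧ ∀ a ∈ X, ∀ b ∈ S, b ∉ X → ¬H.Adj a b := by
  classical
  have h : ¬∀ X ⊆ S, X.Nonempty → X ≠ S → ∃ a ∈ X, ∃ b ∈ S, b ∉ X ∧ H.Adj a b :=
    fun h => hnot ⟨hS.1, h⟩
  push Not at h
  obtain ⟨X, hX, hne, hneS, hcut⟩ := h
  obtain ⟨a, ha, b, hb, hbX, hab⟩ := hS.2 X hX hne hneS
  rcases hab with h | h
  · exact absurd h (hcut a ha b hb hbX)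
  · rw [SimpleGraph.edge_adj] at h
    rcases h.1 with ⟨h1, h2⟩ | ⟨h1, h2⟩
    · subst h1; subst h2
      exact ⟨X, hX, ha, hb, hbX, hcut⟩
    · subst h1; subst h2
      refine ⟨S \ X, Finset.sdiff_subset, by simp [hb, hbX], hX ha, by simp [ha], ?_⟩
      intro c hc d hd hdX hcd
      simp only [Finset.mem_sdiff, not_and, not_not] at hc hdX
      exact hcut d (hdX hd) c hc.1 hc.2 hcd.symm

end ConnectedOn

/-! ### Counting connected sets across added edges. -/

section Count

variable {V : Type*} [Fintype V] [DecidableEq V] {H : SimpleGraph V}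

/-- A connected set either survives in H or splits uniquely at xy into a connected set through x and
one through y. The hypotheses on A and B decide which half contains each of them. -/
theorem connCount_sup_edge {x y : V} {A B : Finset V} (hxy : ¬H.Reachable x y)
    (hA : ∀ a ∈ A, ¬H.Reachable a y) (hB : ∀ b ∈ B, ¬H.Reachable x b) :
    connCount (H ⊔ SimpleGraph.edge x y) (A ∪ B) =
      connCount H (A ∪ B) + connCount H (insert x A) * connCount H (insert y B) := by
  classical
  have hne : x ≠ y := fun h => hxy (h ▸ SimpleGraph.Reachable.refl _)
  unfold connCount
  rw [← Finset.card_product, ← Finset.card_filter_add_card_filter_not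
    (s := connSets (H ⊔ SimpleGraph.edge x y) (A ∪ B)) (fun S => ConnectedOn H S)]
  congr 1
  · congr 1
    ext S
    simp only [Finset.mem_filter, mem_connSets]
    exact ⟨fun h => ⟨h.2, h.1.2⟩, fun h => ⟨⟨h.1.mono le_sup_left, h.2⟩, h.1⟩⟩
  · symm
    refine Finset.card_bij (fun p _ => p.1 ∪ p.2) ?_ ?_ ?_
    · rintro ⟨S₁, S₂⟩ h
      simp only [Finset.mem_product, Finset.mem_filter, mem_connSets,
        Finset.insert_subset_iff] at h ⊢
      obtain ⟨⟨h1, hx, hA1⟩, h2, hy, hB1⟩ := h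
      refine ⟨⟨h1.union_edge h2 hx hy hne, Finset.union_subset_union hA1 hB1⟩, fun hc => ?_⟩
      exact hxy (hc.reachable (Finset.mem_union_left _ hx) (Finset.mem_union_right _ hy))
    -- The halves are recovered from their union as its vertices reachable in H from x and from y.
    · have key : ∀ S₁ S₂ : Finset V, ConnectedOn H S₁ → ConnectedOn H S₂ → x ∈ S₁ → y ∈ S₂ →
          S₁ = (S₁ ∪ S₂).filter (fun v => H.Reachable x v) ∧
          S₂ = (S₁ ∪ S₂).filter (fun v => H.Reachable y v) := by
        intro S₁ S₂ h1 h2 hx hy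
        constructor
        · ext v
          simp only [Finset.mem_filter, Finset.mem_union]
          refine ⟨fun h => ⟨Or.inl h, h1.reachable hx h⟩, fun h => h.1.resolve_right fun hv => ?_⟩
          exact hxy (h.2.trans (h2.reachable hv hy))
        · ext v
          simp only [Finset.mem_filter, Finset.mem_union]
          refine ⟨fun h => ⟨Or.inr h, h2.reachable hy h⟩, fun h => h.1.resolve_left fun hv => ?_⟩
          exact hxy ((h1.reachable hx hv).trans h.2.symm)
      rintro ⟨S₁, S₂⟩ h ⟨T₁, T₂⟩ h' heq
      simp only [Finset.mem_product, mem_connSets, Finset.insert_subset_iff] at h h' heq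
      have e1 := key S₁ S₂ h.1.1 h.2.1 h.1.2.1 h.2.2.1
      have e2 := key T₁ T₂ h'.1.1 h'.2.1 h'.1.2.1 h'.2.2.1
      rw [heq] at e1
      exact Prod.ext (e1.1.trans e2.1.symm) (e1.2.trans e2.2.symm)
    · intro S hS
      simp only [Finset.mem_filter, mem_connSets] at hS
      obtain ⟨X, hX, hxX, hyS, hyX, hcut⟩ := hS.1.1.edge_cases hS.2
      have c1 := hS.1.1.of_cut hX hxX hyX hcut
      have c2 : ConnectedOn H (S \ X) := by
        have := hS.1.1
        rw [SimpleGraph.edge_comm] at this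
        refine this.of_cut Finset.sdiff_subset (by simp [hyS, hyX]) (by simp [hxX]) ?_
        intro c hc d hd hdX hcd
        simp only [Finset.mem_sdiff, not_and, not_not] at hc hdX
        exact hcut d (hdX hd) c hc.1 hc.2 hcd.symm
      refine ⟨(X, S \ X), ?_, by simp [Finset.union_sdiff_of_subset hX]⟩
      simp only [Finset.mem_product, mem_connSets, Finset.insert_subset_iff]
      refine ⟨⟨c1, hxX, fun a ha => ?_⟩, c2, by simp [hyS, hyX], fun b hb => ?_⟩
      · by_contra haX
        exact hA a ha (c2.reachable
          (by simp [hS.1.2 (Finset.mem_union_left _ ha), haX]) (by simp [hyS, hyX]))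
      · refine Finset.mem_sdiff.2 ⟨hS.1.2 (Finset.mem_union_right _ hb), fun hbX => ?_⟩
        exact hB b hb (c1.reachable hxX hbX)

omit [DecidableEq V] in
theorem connCount_eq_zero {A : Finset V} {x y : V} (hx : x ∈ A) (hy : y ∈ A)
    (hxy : ¬H.Reachable x y) : connCount H A = 0 := by
  rw [connCount, Finset.card_eq_zero, Finset.eq_empty_iff_forall_notMem]
  exact fun S h => hxy ((mem_connSets.1 h).1.reachable ((mem_connSets.1 h).2 hx)
    ((mem_connSets.1 h).2 hy))

omit [DecidableEq V] in
theorem connCount_singleton_pos (v : V) : 0 < connCount H {v} :=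
  Finset.card_pos.2 ⟨{v}, mem_connSets.2 ⟨ConnectedOn.singleton v, subset_rfl⟩⟩

theorem connCount_pair_lt {u v : V} (huv : u ≠ v) :
    connCount H {u, v} < connCount H {v} := by
  refine Finset.card_lt_card (Finset.ssubset_iff_subset_ne.2 ⟨?_, ?_⟩)
  · intro S
    simp only [mem_connSets, Finset.insert_subset_iff]
    tauto
  · intro h
    have : ({v} : Finset V) ∈ connSets H {u, v} := by
      rw [h]; exact mem_connSets.2 ⟨ConnectedOn.singleton v, subset_rfl⟩
    simp [mem_connSets, huv] at this

omit [Fintype V] [DecidableEq V] in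
theorem not_reachable_sup_edge {a b x y : V} (hab : ¬H.Reachable a b)
    (h₁ : ¬(H.Reachable a x ∧ H.Reachable y b)) (h₂ : ¬(H.Reachable a y ∧ H.Reachable x b)) :
    ¬(H ⊔ SimpleGraph.edge x y).Reachable a b := by
  rintro ⟨p⟩
  induction p with
  | nil => exact hab (SimpleGraph.Reachable.refl _)
  | @cons c d b h p ih =>
    rcases h with h | h
    · exact ih (fun hd => hab (h.reachable.trans hd))
        (fun hd => h₁ ⟨h.reachable.trans hd.1, hd.2⟩)
        (fun hd => h₂ ⟨h.reachable.trans hd.1, hd.2⟩)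
    · rw [SimpleGraph.edge_adj] at h
      rcases h.1 with ⟨e1, e2⟩ | ⟨e1, e2⟩ <;> subst e1 <;> subst e2
      · exact ih (fun hd => h₁ ⟨SimpleGraph.Reachable.refl _, hd⟩)
          (fun hd => h₁ ⟨SimpleGraph.Reachable.refl _, hd.2⟩)
          (fun hd => hab hd.2)
      · exact ih (fun hd => h₂ ⟨SimpleGraph.Reachable.refl _, hd⟩)
          (fun hd => hab hd.2)
          (fun hd => h₂ ⟨SimpleGraph.Reachable.refl _, hd.2⟩)

/-- Subtree counts after joining two further components at `u` and `v`. -/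
theorem connCount_sup_edge_edge {u u' v v' : V} (huv : H.Reachable u v)
    (huu' : ¬H.Reachable u u') (huv' : ¬H.Reachable u v') (huv'' : ¬H.Reachable u' v') :
    let G := H ⊔ SimpleGraph.edge u u' ⊔ SimpleGraph.edge v v'
    connCount G ∅ = connCount H ∅ + connCount H {u'} * connCount H {u} +
        connCount H {v'} * (connCount H {v} + connCount H {u, v} * connCount H {u'}) ∧
      connCount G {u} = (1 + connCount H {u'}) *
        (connCount H {u} + connCount H {u, v} * connCount H {v'}) ∧
      connCount G {u'} = connCount H {u'} *
        (1 + connCount H {u} + connCount H {u, v} * connCount H {v'}) := by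
  intro G
  have hvu' : ¬H.Reachable v u' := fun h => huu' (huv.trans h)
  have hvv' : ¬H.Reachable v v' := fun h => huv' (huv.trans h)
  have e : ∀ c, H.Reachable c u ∨ H.Reachable c u' →
      ¬(H ⊔ SimpleGraph.edge u u').Reachable c v' := by
    intro c hc
    rcases hc with hc | hc
    · exact not_reachable_sup_edge (fun h => huv' (hc.symm.trans h)) (fun h => huv'' h.2)
        (fun h => huv' h.2)
    · exact not_reachable_sup_edge (fun h => huv'' (hc.symm.trans h)) (fun h => huv'' h.2)
        (fun h => huv' h.2)
  have huv1 : ¬(H ⊔ SimpleGraph.edge u u').Reachable u v' := e u (Or.inl (.refl _))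
  have hvv1 : ¬(H ⊔ SimpleGraph.edge u u').Reachable v v' := e v (Or.inl huv.symm)
  have hu'v1 : ¬(H ⊔ SimpleGraph.edge u u').Reachable u' v' := e u' (Or.inr (.refl _))
  have f0 : connCount (H ⊔ SimpleGraph.edge u u') ∅ =
      connCount H ∅ + connCount H {u} * connCount H {u'} := by
    simpa using connCount_sup_edge (A := ∅) (B := ∅) huu' (by simp) (by simp)
  have fu : connCount (H ⊔ SimpleGraph.edge u u') {u} =
      connCount H {u} + connCount H {u} * connCount H {u'} := by
    simpa using connCount_sup_edge (A := {u}) (B := ∅) huu' (by simpa using huu') (by simp)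
  have fv : connCount (H ⊔ SimpleGraph.edge u u') {v} =
      connCount H {v} + connCount H {u, v} * connCount H {u'} := by
    simpa using connCount_sup_edge (A := {v}) (B := ∅) huu' (by simpa using hvu') (by simp)
  have fuv : connCount (H ⊔ SimpleGraph.edge u u') {v, u} =
      connCount H {u, v} + connCount H {u, v} * connCount H {u'} := by
    rw [Finset.pair_comm]
    simpa using connCount_sup_edge (A := {u, v}) (B := ∅) huu' (by simpa using ⟨huu', hvu'⟩)
      (by simp)
  have fu' : connCount (H ⊔ SimpleGraph.edge u u') {u'} =
      connCount H {u'} + connCount H {u} * connCount H {u'} := by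
    simpa using connCount_sup_edge (A := ∅) (B := {u'}) huu' (by simp) (by simpa using huu')
  have fvu' : connCount (H ⊔ SimpleGraph.edge u u') {v, u'} =
      connCount H {u, v} * connCount H {u'} := by
    have h := connCount_sup_edge (A := {v}) (B := {u'}) huu' (by simpa using hvu')
      (by simpa using huu')
    rw [connCount_eq_zero (A := {v} ∪ {u'}) (x := v) (y := u') (by simp) (by simp) hvu'] at h
    simpa using h
  have fv' : connCount (H ⊔ SimpleGraph.edge u u') {v'} = connCount H {v'} := by
    have h := connCount_sup_edge (A := {v'}) (B := ∅) huu'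
      (by simpa using fun h : H.Reachable v' u' => huv'' h.symm) (by simp)
    rw [connCount_eq_zero (A := insert u {v'}) (x := u) (y := v') (by simp) (by simp) huv'] at h
    simpa using h
  refine ⟨?_, ?_, ?_⟩
  · have := connCount_sup_edge (A := ∅) (B := ∅) hvv1 (by simp) (by simp)
    simp only [Finset.empty_union, insert_empty_eq, f0, fv, fv'] at this
    rw [this]
    ring
  · have := connCount_sup_edge (A := {u}) (B := ∅) hvv1 (by simpa using huv1) (by simp)
    simp only [Finset.union_empty, insert_empty_eq, fu, fuv, fv'] at this
    rw [this]
    ring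
  · have := connCount_sup_edge (A := {u'}) (B := ∅) hvv1 (by simpa using hu'v1) (by simp)
    simp only [Finset.union_empty, insert_empty_eq, fu', fvu', fv'] at this
    rw [this]
    ring

end Count

/-! ### Degrees and degree sums of trees. -/

section Degrees

variable {V : Type*} [Fintype V] [DecidableEq V] {G H T : SimpleGraph V}

/-- The degree of a vertex, without decidability assumptions. -/
noncomputable def vdeg {V : Type*} (G : SimpleGraph V) (v : V) : ℕ :=
  (G.neighborSet v).ncard

theorem vdeg_sup_edge {a b : V} (hab : a ≠ b) (h : ¬H.Adj a b) (v : V) :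
    vdeg (H ⊔ SimpleGraph.edge a b) v =
      vdeg H v + (if v = a then 1 else 0) + (if v = b then 1 else 0) := by
  unfold vdeg
  by_cases hva : v = a
  · subst hva
    have : (H ⊔ SimpleGraph.edge v b).neighborSet v = insert b (H.neighborSet v) := by
      ext w
      simp only [SimpleGraph.mem_neighborSet, SimpleGraph.sup_adj, SimpleGraph.edge_adj,
        Set.mem_insert_iff]
      constructor
      · rintro (h | ⟨⟨-, h⟩ | ⟨h, -⟩, -⟩)
        · exact Or.inr h
        · exact Or.inl h
        · exact absurd h hab
      · rintro (rfl | h)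
        · exact Or.inr ⟨Or.inl ⟨trivial, rfl⟩, hab⟩
        · exact Or.inl h
    rw [this, Set.ncard_insert_of_notMem (by simpa using h)]
    simp [hab]
  · by_cases hvb : v = b
    · subst hvb
      have : (H ⊔ SimpleGraph.edge a v).neighborSet v = insert a (H.neighborSet v) := by
        ext w
        simp only [SimpleGraph.mem_neighborSet, SimpleGraph.sup_adj, SimpleGraph.edge_adj,
          Set.mem_insert_iff]
        constructor
        · rintro (h | ⟨⟨h, -⟩ | ⟨-, h⟩, -⟩)
          · exact Or.inr h
          · exact absurd h hva
          · exact Or.inl h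
        · rintro (rfl | h)
          · exact Or.inr ⟨Or.inr ⟨trivial, rfl⟩, hva⟩
          · exact Or.inl h
      rw [this, Set.ncard_insert_of_notMem (by simpa using fun h' => h h'.symm)]
      simp [hva]
    · have : (H ⊔ SimpleGraph.edge a b).neighborSet v = H.neighborSet v := by
        ext w
        simp only [SimpleGraph.mem_neighborSet, SimpleGraph.sup_adj, SimpleGraph.edge_adj]
        simp [hva, hvb]
      rw [this]
      simp [hva, hvb]

omit [DecidableEq V] in
theorem sum_vdeg (G : SimpleGraph V) : ∑ v, vdeg G v = 2 * Nat.card G.edgeSet := by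
  classical
  rw [Nat.card_eq_fintype_card, ← SimpleGraph.edgeFinset_card,
    ← SimpleGraph.sum_degrees_eq_twice_card_edges]
  refine Finset.sum_congr rfl fun v _ => ?_
  rw [vdeg, Set.ncard_eq_toFinset_card', ← SimpleGraph.card_neighborSet_eq_degree,
    Set.toFinset_card]

omit [DecidableEq V] in
theorem SimpleGraph.IsTree.sum_vdeg (hT : T.IsTree) :
    ∑ v, vdeg T v = 2 * (Fintype.card V - 1) := by
  have := (SimpleGraph.isTree_iff_connected_and_card.1 hT).2
  rw [_root_.sum_vdeg, ← Nat.card_eq_fintype_card (α := V), ← this, Nat.add_sub_cancel]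

-- The degree sum fixes the number of edges, so a connected graph with the degree sum of a tree is a
-- tree.
omit [DecidableEq V] in
theorem SimpleGraph.IsTree.of_reachable_of_sum_vdeg (hT : T.IsTree)
    (hr : ∀ a b, T.Adj a b → G.Reachable a b) (hs : ∑ v, vdeg G v = ∑ v, vdeg T v) :
    G.IsTree := by
  have hc : G.Connected := by
    have := hT.connected
    refine (SimpleGraph.connected_iff _).2 ⟨fun a b => ?_, this.nonempty⟩
    obtain ⟨p⟩ := this.preconnected a b
    induction p with
    | nil => exact .refl _
    | cons h p ih => exact (hr _ _ h).trans ih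
  refine SimpleGraph.isTree_iff_connected_and_card.2 ⟨hc, ?_⟩
  have h1 := (SimpleGraph.isTree_iff_connected_and_card.1 hT).2
  rw [_root_.sum_vdeg, _root_.sum_vdeg] at hs
  omega

omit [DecidableEq V] in
theorem SimpleGraph.Connected.vdeg_pos [Nontrivial V] (hG : G.Connected) (v : V) :
    0 < vdeg G v := by
  obtain ⟨w, hw⟩ := hG.preconnected.exists_adj_of_nontrivial v
  exact (Set.ncard_pos (Set.toFinite _)).2 ⟨w, hw⟩

end Degrees

/-! ### Deleting edges of a forest. -/

section Delete

variable {V : Type*} {T : SimpleGraph V}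

theorem SimpleGraph.IsAcyclic.not_reachable_deleteEdges (hT : T.IsAcyclic) {v w : V}
    (h : T.Adj v w) : ¬(T.deleteEdges {s(v, w)}).Reachable v w :=
  SimpleGraph.isBridge_iff.1 (SimpleGraph.isAcyclic_iff_forall_adj_isBridge.1 hT h)

theorem SimpleGraph.deleteEdges_sup_edge {v w : V} (h : T.Adj v w) :
    T.deleteEdges {s(v, w)} ⊔ SimpleGraph.edge v w = T := by
  ext a b
  simp only [SimpleGraph.sup_adj, SimpleGraph.deleteEdges_adj, SimpleGraph.edge_adj,
    Set.mem_singleton_iff, Sym2.eq_iff]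
  constructor
  · rintro (h' | ⟨⟨rfl, rfl⟩ | ⟨rfl, rfl⟩, -⟩)
    · exact h'.1
    · exact h
    · exact h.symm
  · intro h'
    by_cases hc : a = v ∧ b = w ∨ a = w ∧ b = v
    · exact Or.inr ⟨hc, h'.ne⟩
    · exact Or.inl ⟨h', hc⟩

/-- Both edges are bridges; together with `huv`, each excluded connection would join the ends of one
of them without using it. -/
theorem SimpleGraph.IsAcyclic.deleteEdges_pair (hT : T.IsAcyclic) {u u' v v' : V}
    (hu : T.Adj u u') (hv : T.Adj v v') (hne : s(u, u') ≠ s(v, v'))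
    (huv : (T.deleteEdges {s(u, u'), s(v, v')}).Reachable u v) :
    T.deleteEdges {s(u, u'), s(v, v')} ⊔ SimpleGraph.edge u u' ⊔ SimpleGraph.edge v v' = T ∧
      ¬(T.deleteEdges {s(u, u'), s(v, v')}).Reachable u u' ∧
      ¬(T.deleteEdges {s(u, u'), s(v, v')}).Reachable u v' ∧
      ¬(T.deleteEdges {s(u, u'), s(v, v')}).Reachable u' v' := by
  have e1 : T.deleteEdges {s(u, u'), s(v, v')} =
      (T.deleteEdges {s(v, v')}).deleteEdges {s(u, u')} := by
    rw [SimpleGraph.deleteEdges_deleteEdges, Set.union_comm]; rfl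
  have l1 : T.deleteEdges {s(u, u'), s(v, v')} ≤ T.deleteEdges {s(u, u')} :=
    SimpleGraph.deleteEdges_anti (by simp)
  have l2 : T.deleteEdges {s(u, u'), s(v, v')} ≤ T.deleteEdges {s(v, v')} :=
    SimpleGraph.deleteEdges_anti (by simp)
  have hu2 : (T.deleteEdges {s(v, v')}).Adj u u' :=
    SimpleGraph.deleteEdges_adj.2 ⟨hu, by simpa using hne⟩
  have b1 := hT.not_reachable_deleteEdges hu
  have b2 := hT.not_reachable_deleteEdges hv
  refine ⟨?_, fun h => b1 (h.mono l1), fun h => b2 ((huv.symm.trans h).mono l2), fun h => ?_⟩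
  · rw [e1, SimpleGraph.deleteEdges_sup_edge hu2, SimpleGraph.deleteEdges_sup_edge hv]
  · exact b2 (((huv.symm.mono l2).trans hu2.reachable).trans (h.mono l2))

end Delete

/-! ### Moving and exchanging branches. -/

section Moves

/-- Here a, b, z count the sets through u', through v', and through both u and v, while z + p + 1
and z + q + 1 count those through u and v, all after deletion of both edges. The first hypothesis
says (a − b)(p − q) ≥ 0, so a, p and b, q are ordered alike; the second then excludes the reversed
order. -/
theorem switch_arith {a b p q z : ℕ} (hle : b * p + a * q ≤ a * p + b * q)
    (hf : (1 + b) * (q + 1) ≤ (1 + a) * (p + 1)) :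
    b * (1 + (z + q + 1) + z * a) ≤ a * (1 + (z + p + 1) + z * b) := by
  have hab : b ≤ a := by
    by_contra! hab
    rcases le_or_gt p q with h | h
    · exact absurd hf (not_le.2 (Nat.mul_lt_mul_of_lt_of_le (by omega) (by omega) (by omega)))
    · obtain ⟨k, rfl⟩ := Nat.exists_eq_add_of_lt hab
      obtain ⟨l, rfl⟩ := Nat.exists_eq_add_of_lt h
      ring_nf at hle
      omega
  have hpq : q ≤ p := by
    by_contra! h
    rcases hab.eq_or_lt with rfl | hab
    · exact absurd hf (not_le.2 (Nat.mul_lt_mul_of_pos_left (by omega) (by omega)))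
    · obtain ⟨k, rfl⟩ := Nat.exists_eq_add_of_lt hab
      obtain ⟨l, rfl⟩ := Nat.exists_eq_add_of_lt h
      ring_nf at hle
      omega
  have := Nat.mul_le_mul hab (show z + q + 2 ≤ z + p + 2 by omega)
  linarith

variable {V : Type*} [Fintype V] [DecidableEq V] {T : SimpleGraph V}

/-- Moving a branch `w` from `v` to a vertex `u` lying in at least as many subtrees. -/
theorem SimpleGraph.IsTree.exists_move (hT : T.IsTree) {u v w : V} (huv : u ≠ v)
    (hvw : T.Adj v w) (hr : (T.deleteEdges {s(v, w)}).Reachable u v)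
    (hf : connCount T {v} ≤ connCount T {u}) :
    ∃ T' : SimpleGraph V, T'.IsTree ∧
      (∀ x, vdeg T' x + (if x = v then 1 else 0) = vdeg T x + (if x = u then 1 else 0)) ∧
      connCount T ∅ < connCount T' ∅ := by
  set H := T.deleteEdges {s(v, w)} with hH
  have hTH : H ⊔ SimpleGraph.edge v w = T := SimpleGraph.deleteEdges_sup_edge hvw
  have hvw' : ¬H.Reachable v w := hT.isAcyclic.not_reachable_deleteEdges hvw
  have huw' : ¬H.Reachable u w := fun h => hvw' (hr.symm.trans h)
  have huw : u ≠ w := fun h => huw' (h ▸ .refl _)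
  have hdeg : ∀ x, vdeg (H ⊔ SimpleGraph.edge u w) x + (if x = v then 1 else 0) =
      vdeg T x + (if x = u then 1 else 0) := by
    intro x
    have h1 := vdeg_sup_edge huw (fun h => huw' h.reachable) x
    have h2 := vdeg_sup_edge hvw.ne (fun h => hvw' h.reachable) x
    rw [hTH] at h2
    omega
  refine ⟨H ⊔ SimpleGraph.edge u w, ?_, hdeg, ?_⟩
  · refine hT.of_reachable_of_sum_vdeg (fun a b hab => ?_) ?_
    · rw [← hTH] at hab
      rcases hab with h | h
      · exact SimpleGraph.Adj.reachable (Or.inl h)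
      · have hvw2 : (H ⊔ SimpleGraph.edge u w).Reachable v w :=
          (hr.symm.mono le_sup_left).trans (SimpleGraph.Adj.reachable
            (Or.inr (by simp [SimpleGraph.edge_adj, huw])))
        rw [SimpleGraph.edge_adj] at h
        rcases h.1 with ⟨rfl, rfl⟩ | ⟨rfl, rfl⟩
        · exact hvw2
        · exact hvw2.symm
    · have := Finset.sum_congr (rfl : (Finset.univ : Finset V) = _) (fun x _ => hdeg x)
      simpa [Finset.sum_add_distrib] using this
  · have c0 := connCount_sup_edge (A := ∅) (B := ∅) hvw' (by simp) (by simp)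
    have cv := connCount_sup_edge (A := {v}) (B := ∅) hvw' (by simpa using hvw') (by simp)
    have cu := connCount_sup_edge (A := {u}) (B := ∅) hvw' (by simpa using huw') (by simp)
    have c0' := connCount_sup_edge (A := ∅) (B := ∅) huw' (by simp) (by simp)
    rw [hTH] at c0 cv cu
    simp only [Finset.union_empty, insert_empty_eq, Finset.insert_eq_of_mem,
      Finset.mem_singleton] at c0 cv cu c0'
    rw [c0, c0']
    rw [cv, cu, Finset.pair_comm] at hf
    have hlt := connCount_pair_lt (H := H) huv
    have hw := connCount_singleton_pos (H := H) w
    -- Writing h for counts in H, `hf` reads h(v) + h(v)h(w) ≤ h(u) + h(u,v)h(w), and h(u,v) < h(v).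
    -- The gain of the move is (h(u) − h(v))h(w).
    have : connCount H {v} < connCount H {u} := by nlinarith
    nlinarith

/-- If exchanging the branches `u'` at `u` and `v'` at `v` does not increase the number of
subtrees, then the order of `u, v` carries over to `u', v'`. -/
theorem SimpleGraph.IsTree.exists_switch (hT : T.IsTree) {u u' v v' : V} (huv : u ≠ v)
    (hu : T.Adj u u') (hv : T.Adj v v') (hne : s(u, u') ≠ s(v, v'))
    (hr : (T.deleteEdges {s(u, u'), s(v, v')}).Reachable u v) :
    ∃ T' : SimpleGraph V, T'.IsTree ∧ (∀ x, vdeg T' x = vdeg T x) ∧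
      (connCount T' ∅ ≤ connCount T ∅ → connCount T {v} ≤ connCount T {u} →
        connCount T {v'} ≤ connCount T {u'}) := by
  obtain ⟨hTH, huu', huv', huv''⟩ := hT.isAcyclic.deleteEdges_pair hu hv hne hr
  set H := T.deleteEdges {s(u, u'), s(v, v')} with hH
  have hvu' : ¬H.Reachable v u' := fun h => huu' (hr.trans h)
  have hvv' : ¬H.Reachable v v' := fun h => huv' (hr.trans h)
  have hne1 : u ≠ v' := fun h => huv' (h ▸ .refl _)
  have hne2 : v ≠ u' := fun h => hvu' (h ▸ .refl _)
  have hdeg : ∀ x, vdeg (H ⊔ SimpleGraph.edge u v' ⊔ SimpleGraph.edge v u') x = vdeg T x := by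
    intro x
    have a1 : ¬(H ⊔ SimpleGraph.edge u v').Adj v u' := by
      rintro (h | h)
      · exact hvu' h.reachable
      · rw [SimpleGraph.edge_adj] at h
        rcases h.1 with ⟨h, -⟩ | ⟨h, -⟩
        · exact huv h.symm
        · exact hvv' (h ▸ .refl _)
    have a2 : ¬(H ⊔ SimpleGraph.edge u u').Adj v v' := by
      rintro (h | h)
      · exact hvv' h.reachable
      · rw [SimpleGraph.edge_adj] at h
        rcases h.1 with ⟨h, -⟩ | ⟨h, -⟩
        · exact huv h.symm
        · exact hne2 h
    have h1 := vdeg_sup_edge hne1 (fun h => huv' h.reachable) x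
    have h2 := vdeg_sup_edge hne2 a1 x
    have h3 := vdeg_sup_edge hu.ne (fun h => huu' h.reachable) x
    have h4 := vdeg_sup_edge hv.ne a2 x
    rw [hTH] at h4
    omega
  refine ⟨H ⊔ SimpleGraph.edge u v' ⊔ SimpleGraph.edge v u', ?_, hdeg, ?_⟩
  · refine hT.of_reachable_of_sum_vdeg (fun a b hab => ?_)
      (Finset.sum_congr rfl fun x _ => hdeg x)
    set G := H ⊔ SimpleGraph.edge u v' ⊔ SimpleGraph.edge v u' with hG
    have hHG : H ≤ G := le_sup_left.trans le_sup_left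
    have r1 : G.Reachable u v' := SimpleGraph.Adj.reachable
      (Or.inl (Or.inr (by simp [SimpleGraph.edge_adj, hne1])))
    have r2 : G.Reachable v u' := SimpleGraph.Adj.reachable
      (Or.inr (by simp [SimpleGraph.edge_adj, hne2]))
    have r0 : G.Reachable u v := hr.mono hHG
    rw [← hTH] at hab
    rcases hab with (h | h) | h
    · exact (hHG h).reachable
    · rw [SimpleGraph.edge_adj] at h
      rcases h.1 with ⟨rfl, rfl⟩ | ⟨rfl, rfl⟩
      · exact r0.trans r2
      · exact (r0.trans r2).symm
    · rw [SimpleGraph.edge_adj] at h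
      rcases h.1 with ⟨rfl, rfl⟩ | ⟨rfl, rfl⟩
      · exact r0.symm.trans r1
      · exact (r0.symm.trans r1).symm
  · intro hle hf
    have c := connCount_sup_edge_edge hr huu' huv' huv''
    have c' := connCount_sup_edge_edge hr huv' huu' (fun h => huv'' h.symm)
    -- The same tree with the roles of u and v exchanged supplies the counts at v and v'.
    have d := connCount_sup_edge_edge hr.symm hvv' hvu' (fun h => huv'' h.symm)
    rw [sup_right_comm] at d
    rw [hTH] at c d
    dsimp only at c c' d
    rw [Finset.pair_comm v u] at d
    rw [c.1, c'.1] at hle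
    rw [c.2.1, d.2.1] at hf
    rw [c.2.2, d.2.2]
    have hzx := connCount_pair_lt (H := H) huv.symm
    have hzy := connCount_pair_lt (H := H) huv
    rw [Finset.pair_comm] at hzx
    have ha := connCount_singleton_pos (H := H) u'
    have hb := connCount_singleton_pos (H := H) v'
    generalize connCount H {u'} = a at *
    generalize connCount H {v'} = b at *
    generalize connCount H {u} = x at *
    generalize connCount H {v} = y at *
    generalize connCount H {u, v} = z at *
    obtain ⟨p, rfl⟩ := Nat.exists_eq_add_of_lt hzx
    obtain ⟨q, rfl⟩ := Nat.exists_eq_add_of_lt hzy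
    exact switch_arith (by linarith) (by linarith)

/-- The number of subtrees containing a vertex is concave along paths, in a weak sense. -/
theorem SimpleGraph.IsTree.connCount_le_of_path (hT : T.IsTree) {x y z : V} (hxz : x ≠ z)
    (hxy : T.Adj x y) (hyz : T.Adj y z) (hf : connCount T {y} ≤ connCount T {x}) :
    connCount T {z} ≤ connCount T {y} := by
  have hne : s(y, x) ≠ s(y, z) := by simpa [Sym2.eq_iff] using ⟨hxz, fun h => absurd h hyz.ne⟩
  obtain ⟨hTH, h1, h2, h3⟩ := hT.isAcyclic.deleteEdges_pair hxy.symm hyz hne (.refl _)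
  set H := T.deleteEdges {s(y, x), s(y, z)} with hH
  have c := connCount_sup_edge_edge (.refl y) h1 h2 h3
  have d := connCount_sup_edge_edge (.refl y) h2 h1 (fun h => h3 h.symm)
  rw [sup_right_comm] at d
  rw [hTH] at c d
  dsimp only at c d
  simp only [Finset.insert_eq_of_mem, Finset.mem_singleton] at c d
  rw [c.2.1, c.2.2] at hf
  rw [c.2.1, d.2.2]
  have hy := connCount_singleton_pos (H := H) y
  generalize connCount H {x} = a at *
  generalize connCount H {z} = b at *
  generalize connCount H {y} = e at *
  -- This is `hf` after cancellation; the goal reduces to b ≤ e + e * a, which follows because e ≥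
  -- 1.
  have h4 : e + e * b ≤ a := by linarith
  have h5 : 1 * b ≤ e * b := Nat.mul_le_mul_right b hy
  have h6 : 1 * a ≤ e * a := Nat.mul_le_mul_right a hy
  linarith

end Moves

/-! ### Rooted trees and parent maps. -/

/-- `p` maps every vertex of `T` other than the root `r` to its neighbour closest to `r`. -/
structure IsParentMap {V : Type*} (T : SimpleGraph V) (r : V) (p : V → V) : Prop where
  root : p r = r
  adj : ∀ v, v ≠ r → T.Adj v (p v)
  dist : ∀ v, v ≠ r → T.dist r v = T.dist r (p v) + 1
  eq_of_adj : ∀ a b, T.Adj a b → (a ≠ r ∧ p a = b) ∨ (b ≠ r ∧ p b = a)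

section Parent

variable {V : Type*} {T : SimpleGraph V} {r : V} {p : V → V}

/-- Every non-root vertex has a neighbour one step closer to r. Comparing distances shows that the
edges to these neighbours are distinct, and there are as many of them as the tree has edges, so they
are all the edges. -/
theorem SimpleGraph.IsTree.exists_isParentMap [Fintype V] (hT : T.IsTree) (r : V) :
    ∃ p, IsParentMap T r p := by
  classical
  have hex : ∀ v, ∃ w, (v = r → w = r) ∧ (v ≠ r → T.Adj v w ∧ T.dist r v = T.dist r w + 1) := by
    intro v
    by_cases hv : v = r
    · exact ⟨r, by simp [hv]⟩
    · obtain ⟨q, hq, hlen⟩ := hT.connected.exists_path_of_dist r v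
      have hnil : ¬q.Nil := fun h => hv h.eq.symm
      have hadj := (q.adj_penultimate hnil).symm
      refine ⟨q.penultimate, fun h => absurd h hv, fun _ => ⟨hadj, ?_⟩⟩
      rcases hT.dist_eq_dist_add_one_of_adj r hadj with h | h
      · exact h
      · have h1 := SimpleGraph.dist_le q.dropLast
        have h2 : q.dropLast.length = q.length - 1 := by simp
        omega
  choose p hp using hex
  have hinj : Set.InjOn (fun v => s(v, p v)) ((Finset.univ.erase r : Finset V) : Set V) := by
    intro a ha b hb hab
    simp only [Finset.coe_erase, Finset.coe_univ, Set.mem_sdiff, Set.mem_univ, true_and,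
      Set.mem_singleton_iff] at ha hb
    have h1 := ((hp a).2 ha).2
    have h2 := ((hp b).2 hb).2
    rcases Sym2.eq_iff.1 hab with ⟨h, -⟩ | ⟨h, h'⟩
    · exact h
    · rw [h'] at h1; rw [← h] at h2; omega
  have hsub : (Finset.univ.erase r).image (fun v => s(v, p v)) ⊆ T.edgeFinset := by
    intro e he
    obtain ⟨v, hv, rfl⟩ := Finset.mem_image.1 he
    exact SimpleGraph.mem_edgeFinset.2 ((hp v).2 (Finset.ne_of_mem_erase hv)).1
  have heq := Finset.eq_of_subset_of_card_le hsub (by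
    rw [Finset.card_image_of_injOn hinj, Finset.card_erase_of_mem (Finset.mem_univ r),
      Finset.card_univ, ← hT.card_edgeFinset]
    simp)
  refine ⟨p, (hp r).1 rfl, fun v hv => ((hp v).2 hv).1, fun v hv => ((hp v).2 hv).2, ?_⟩
  intro a b hab
  have : s(a, b) ∈ (Finset.univ.erase r).image (fun v => s(v, p v)) := by
    rw [heq]; exact SimpleGraph.mem_edgeFinset.2 hab
  obtain ⟨v, hv, he⟩ := Finset.mem_image.1 this
  have hv := Finset.ne_of_mem_erase hv
  rcases Sym2.eq_iff.1 he with ⟨h, h'⟩ | ⟨h, h'⟩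
  · exact Or.inl ⟨h ▸ hv, h ▸ h'⟩
  · exact Or.inr ⟨h ▸ hv, h ▸ h'⟩

namespace IsParentMap

theorem edge_injective (hp : IsParentMap T r p) {a b : V} (ha : a ≠ r) (hb : b ≠ r)
    (h : s(a, p a) = s(b, p b)) : a = b := by
  have h1 := hp.dist a ha
  have h2 := hp.dist b hb
  rcases Sym2.eq_iff.1 h with ⟨h, -⟩ | ⟨h, h'⟩
  · exact h
  · rw [h'] at h1; rw [← h] at h2; omega

theorem dist_iterate_le (hp : IsParentMap T r p) (k : ℕ) (v : V) :
    T.dist r (p^[k] v) ≤ T.dist r v := by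
  induction k generalizing v with
  | zero => simp
  | succ k ih =>
    rw [Function.iterate_succ_apply]
    refine (ih (p v)).trans ?_
    by_cases hv : v = r
    · rw [hv, hp.root]
    · have := hp.dist v hv; omega

theorem iterate_parent_ne (hp : IsParentMap T r p) {v : V} (hv : v ≠ r) (k : ℕ) :
    p^[k] (p v) ≠ v := fun h => by
  have h1 := hp.dist_iterate_le k (p v)
  rw [h] at h1
  have := hp.dist v hv
  omega

/-- The path of successive parents uses only parent edges of its own vertices, so it avoids the
deleted ones. -/
theorem reachable_root (hp : IsParentMap T r p) {B : Set V} (hr : r ∉ B) {y : V}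
    (hy : ∀ k, p^[k] y ∉ B) :
    (T.deleteEdges ((fun b => s(b, p b)) '' B)).Reachable y r := by
  induction hd : T.dist r y using Nat.strong_induction_on generalizing y with
  | _ d ih =>
    by_cases hyr : y = r
    · rw [hyr]
    · have h1 := hp.dist y hyr
      refine SimpleGraph.Reachable.trans (SimpleGraph.Adj.reachable ?_)
        (ih (T.dist r (p y)) (by omega) (y := p y) (fun k => hy (k + 1)) rfl)
      refine SimpleGraph.deleteEdges_adj.2 ⟨hp.adj y hyr, ?_⟩
      rintro ⟨b, hb, he⟩
      have := hp.edge_injective (fun h => hr (h ▸ hb)) hyr he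
      exact hy 0 (this ▸ hb)

theorem reachable_pair (hp : IsParentMap T r p) {u v : V} (hu : u ≠ r) (hv : v ≠ r)
    (huv : ∀ k, p^[k] (p v) ≠ u) (hvu : ∀ k, p^[k] (p u) ≠ v) :
    (T.deleteEdges {s(p u, u), s(p v, v)}).Reachable (p u) (p v) := by
  have hB : ({s(p u, u), s(p v, v)} : Set (Sym2 V)) = (fun b => s(b, p b)) '' {u, v} := by
    rw [Set.image_pair, Sym2.eq_swap, Sym2.eq_swap (a := p v)]
  have hr : r ∉ ({u, v} : Set V) := by simp [hu.symm, hv.symm]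
  rw [hB]
  refine (hp.reachable_root hr (fun k => ?_)).trans (hp.reachable_root hr (fun k => ?_)).symm
  · simpa using ⟨hp.iterate_parent_ne hu k, hvu k⟩
  · simpa using ⟨huv k, hp.iterate_parent_ne hv k⟩

end IsParentMap

/-- A vertex of degree at least two has a neighbour that does not lie towards `u`. -/
theorem SimpleGraph.IsTree.exists_adj_reachable [Fintype V] (hT : T.IsTree) {u v : V}
    (hdeg : 2 ≤ vdeg T v) :
    ∃ w, T.Adj v w ∧ (T.deleteEdges {s(v, w)}).Reachable u v := by
  obtain ⟨p, hp⟩ := hT.exists_isParentMap u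
  -- With the tree rooted at u, a neighbour other than `p v` is a child of v.
  obtain ⟨w, hw, hwp⟩ := Set.exists_ne_of_one_lt_ncard hdeg (p v)
  rw [SimpleGraph.mem_neighborSet] at hw
  refine ⟨w, hw, ?_⟩
  rcases hp.eq_of_adj v w hw with h | ⟨hwu, h⟩
  · exact absurd h.2.symm hwp
  · have := hp.reachable_root (B := {w}) (by simpa using hwu.symm) (y := v) (fun k => by
      simpa [h] using hp.iterate_parent_ne hwu k)
    rw [Set.image_singleton, h, Sym2.eq_swap] at this
    exact this.symm

end Parent

/-! ### Breadth-first order of a tree that is optimal for its degrees. -/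

section Order

/-- A mixed radix key listing the vertices in breadth-first order, siblings being sorted by
`rank`. -/
def bfsKey {V : Type*} (p : V → V) (rank : V → ℕ) (N : ℕ) : ℕ → V → ℕ
  | 0, _ => 1
  | k + 1, v => bfsKey p rank N k (p v) * N + rank v

variable {n : ℕ} {T : SimpleGraph (Fin n)}

/-- The maximum at r starts the induction, and `connCount_le_of_path` propagates the inequality away
from the root. -/
theorem connCount_le_parent {r : Fin n} {p : Fin n → Fin n} (hT : T.IsTree)
    (hp : IsParentMap T r p) (hr : ∀ v, connCount T {v} ≤ connCount T {r}) (v : Fin n) :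
    connCount T {v} ≤ connCount T {p v} := by
  induction hd : T.dist r v using Nat.strong_induction_on generalizing v with
  | _ d ih =>
    by_cases hv : v = r
    · rw [hv, hp.root]
    by_cases hpv : p v = r
    · rw [hpv]; exact hr v
    have h1 := hp.dist v hv
    have h2 := hp.dist (p v) hpv
    refine hT.connCount_le_of_path (x := p (p v)) ?_ (hp.adj _ hpv).symm (hp.adj _ hv).symm
      (ih _ (by omega) (p v) rfl)
    intro h
    rw [h] at h2
    omega

/-- The root maximizes f. In base N the key of v is a leading 1 followed by the ranks along the path
from the root: numerical order is by level, then lexicographic, and dividing by N passes to the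
parent. Monotonicity of f along the key follows by induction from parents to children through
`exists_switch`. -/
theorem exists_bfs_key (hn : 2 ≤ n) (hT : T.IsTree)
    (hopt : ∀ T' : SimpleGraph (Fin n), T'.IsTree → (∀ x, vdeg T' x = vdeg T x) →
      connCount T' ∅ ≤ connCount T ∅) :
    ∃ r p, IsParentMap T r p ∧ ∃ K : Fin n → ℕ, Function.Injective K ∧ (∀ v, K r ≤ K v) ∧
      (∀ v, v ≠ r → K (p v) < K v) ∧
      (∀ u v, u ≠ r → v ≠ r → K u ≤ K v → K (p u) ≤ K (p v)) ∧
      ∀ u v, K u ≤ K v → connCount T {v} ≤ connCount T {u} := by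
  have : NeZero n := ⟨by omega⟩
  obtain ⟨r, -, hr⟩ := Finset.exists_max_image Finset.univ (fun v => connCount T {v})
    ⟨(0 : Fin n), Finset.mem_univ _⟩
  replace hr := fun v => hr v (Finset.mem_univ v)
  obtain ⟨p, hp⟩ := hT.exists_isParentMap r
  set f : Fin n → ℕ := fun v => connCount T {v} with hf
  -- Larger f gives smaller rank; the label breaks ties, which makes rank injective.
  set rank : Fin n → ℕ := fun v => (f r - f v) * n + v with hrank
  set N := (f r + 1) * n with hN
  have hrankN : ∀ v, rank v < N := by
    intro v
    have : (f r - f v) * n ≤ f r * n := Nat.mul_le_mul_right _ (Nat.sub_le _ _)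
    have := v.2
    simp only [hrank, hN, add_mul, one_mul]
    omega
  have hdivrank : ∀ v, rank v / n = f r - f v := by
    intro v
    simp only [hrank]
    rw [Nat.add_comm, Nat.add_mul_div_right _ _ (by omega), Nat.div_eq_of_lt v.2, zero_add]
  have hrank_le : ∀ u v, rank u ≤ rank v → f v ≤ f u := by
    intro u v h
    have := Nat.div_le_div_right (c := n) h
    rw [hdivrank, hdivrank] at this
    have h1 := hr u
    have h2 := hr v
    simp only [hf] at *
    omega
  have hrank_inj : ∀ u v, rank u = rank v → u = v := by
    intro u v h
    have := congrArg (· % n) h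
    simp only [hrank,
      Nat.add_comm _ (Fin.val _), Nat.add_mul_mod_self_right, Nat.mod_eq_of_lt u.2,
      Nat.mod_eq_of_lt v.2] at this
    exact Fin.ext this
  have hN2 : 2 ≤ N := by nlinarith
  set K : Fin n → ℕ := fun v => bfsKey p rank N (T.dist r v) v with hK
  have hKr : K r = 1 := by simp [hK, bfsKey]
  have hKv : ∀ v, v ≠ r → K v = K (p v) * N + rank v := by
    intro v hv
    simp only [hK]
    rw [hp.dist v hv, bfsKey]
  have hpos : ∀ k v, 0 < bfsKey p rank N k v := by
    intro k
    induction k with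
    | zero => simp [bfsKey]
    | succ k ih => intro v; rw [bfsKey]; have := Nat.mul_pos (ih (p v)) (by omega : 0 < N); omega
  have hKpos : ∀ v, 0 < K v := fun v => hpos _ _
  have hKdiv : ∀ v, v ≠ r → K v / N = K (p v) := by
    intro v hv
    rw [hKv v hv, Nat.add_comm, Nat.add_mul_div_right _ _ (by omega),
      Nat.div_eq_of_lt (hrankN v), zero_add]
  have hKmod : ∀ v, v ≠ r → K v % N = rank v := by
    intro v hv
    rw [hKv v hv, Nat.add_comm, Nat.add_mul_mod_self_right, Nat.mod_eq_of_lt (hrankN v)]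
  have hlt : ∀ v, v ≠ r → K (p v) < K v := by
    intro v hv
    have h1 := hKv v hv
    have := hKpos (p v)
    nlinarith
  have hroot : ∀ v, K v = 1 → v = r := by
    intro v hv
    by_contra h
    have := hlt v h
    have := hKpos (p v)
    omega
  have hmono : ∀ u v, u ≠ r → v ≠ r → K u ≤ K v → K (p u) ≤ K (p v) := by
    intro u v hu hv h
    rw [← hKdiv u hu, ← hKdiv v hv]
    exact Nat.div_le_div_right h
  have hinj : Function.Injective K := by
    intro u v h
    by_cases hu : u = r
    · rw [hu, hroot v (by rw [← h, hu, hKr])]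
    by_cases hv : v = r
    · exact absurd (hroot u (by rw [h, hv, hKr])) hu
    exact hrank_inj u v (by rw [← hKmod u hu, ← hKmod v hv, h])
  have hKp : ∀ v, K (p v) ≤ K v := by
    intro v
    by_cases hv : v = r
    · rw [hv, hp.root]
    · exact (hlt v hv).le
  have hKit : ∀ k v, K (p^[k] v) ≤ K v := by
    intro k
    induction k with
    | zero => simp
    | succ k ih => intro v; rw [Function.iterate_succ_apply]; exact (ih _).trans (hKp v)
  have hfit : ∀ k v, f v ≤ f (p^[k] v) := by
    intro k
    induction k with
    | zero => simp
    | succ k ih =>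
      intro v
      rw [Function.iterate_succ_apply]
      exact (connCount_le_parent hT hp hr v).trans (ih _)
  refine ⟨r, p, hp, K, hinj, fun v => by rw [hKr]; exact hKpos v, hlt, hmono, ?_⟩
  intro u v
  induction hd : K v using Nat.strong_induction_on generalizing u v with
  | _ d ih =>
    intro huv
    by_cases hu : u = r
    · rw [hu]; exact hr v
    by_cases hv : v = r
    · rw [← hd, hv, hKr] at huv
      exact absurd (hroot u (le_antisymm huv (hKpos u))) hu
    have hpp := hmono u v hu hv (hd ▸ huv)
    by_cases hpe : p u = p v
    · refine hrank_le u v ?_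
      have h1 := hKv u hu
      have h2 := hKv v hv
      rw [hpe] at h1
      omega
    have hpf := ih (K (p v)) (hd ▸ hlt v hv) (p u) (p v) rfl hpp
    -- If u is an ancestor of v, exchanging branches makes no sense, but f does not decrease towards
    -- the root anyway. Conversely v cannot be an ancestor of u, since keys strictly decrease
    -- towards the root.
    by_cases hanc : ∃ k, p^[k] (p v) = u
    · obtain ⟨k, rfl⟩ := hanc
      exact hfit (k + 1) v
    have hanc' : ∀ k, p^[k] (p u) ≠ v := by
      intro k h
      have h1 := hKit k (p u)
      have h2 := hlt u hu
      rw [h] at h1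
      omega
    push Not at hanc
    have hne : u ≠ v := fun h => hpe (h ▸ rfl)
    obtain ⟨T', hT', hdeg, hsw⟩ := hT.exists_switch hpe (hp.adj u hu).symm (hp.adj v hv).symm
      (fun h => hne (hp.edge_injective hu hv (by rw [Sym2.eq_swap, h, Sym2.eq_swap])))
      (hp.reachable_pair hu hv hanc hanc')
    exact hsw (hopt T' hT' hdeg) hpf

end Order

/-! ### Majorization and unit transfers. -/

section Sequences

theorem sum_le_sum_range_of_antitone {e : ℕ → ℕ} (he : Antitone e) (S : Finset ℕ) :
    ∑ i ∈ S, e i ≤ ∑ i ∈ Finset.range S.card, e i := by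
  induction hk : S.card generalizing S with
  | zero => simp [Finset.card_eq_zero.1 hk]
  | succ k ih =>
    have hne : S.Nonempty := Finset.card_pos.1 (by omega)
    have hmax := S.max'_mem hne
    have hcard : (S.erase (S.max' hne)).card = k := by
      rw [Finset.card_erase_of_mem hmax]; omega
    have hle : k ≤ S.max' hne := by
      have : S ⊆ Finset.range (S.max' hne + 1) := fun x hx =>
        Finset.mem_range.2 (Nat.lt_succ_of_le (S.le_max' x hx))
      have := Finset.card_le_card this
      rw [Finset.card_range] at this
      omega
    rw [← Finset.sum_erase_add _ _ hmax, Finset.sum_range_succ]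
    exact Nat.add_le_add (ih _ hcard) (he hle)

/-- If `e` is strictly majorized by `d`, then one unit can be moved from a later entry of `e` to
an earlier one so that the result is still majorized by `d`. -/
theorem exists_transfer {e d : ℕ → ℕ} (he : Antitone e) (hd : Antitone d) {n : ℕ}
    (hle : ∀ k, ∑ i ∈ Finset.range k, e i ≤ ∑ i ∈ Finset.range k, d i)
    (hsum : ∑ i ∈ Finset.range n, e i = ∑ i ∈ Finset.range n, d i)
    (hne : ∃ i < n, e i ≠ d i) :
    ∃ p q, p < q ∧ q < n ∧ d q < e q ∧ ∀ S : Finset ℕ,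
      ∑ i ∈ S, e i + (if p ∈ S then 1 else 0) ≤
        ∑ i ∈ Finset.range S.card, d i + (if q ∈ S then 1 else 0) := by
  classical
  -- The first index where the sequences differ; majorization forces e p < d p.
  set p := Nat.find hne with hp
  obtain ⟨hpn, hpne⟩ : p < n ∧ e p ≠ d p := Nat.find_spec hne
  have hpmin : ∀ i < p, e i = d i := by
    intro i hi
    have := Nat.find_min hne hi
    push Not at this
    exact this (hi.trans hpn)
  have hEp : ∑ i ∈ Finset.range p, e i = ∑ i ∈ Finset.range p, d i :=
    Finset.sum_congr rfl fun i hi => hpmin i (Finset.mem_range.1 hi)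
  have hpd : e p < d p := by
    have := hle (p + 1)
    rw [Finset.sum_range_succ, Finset.sum_range_succ, hEp] at this
    omega
  have hEp1 : ∑ i ∈ Finset.range (p + 1), e i < ∑ i ∈ Finset.range (p + 1), d i := by
    rw [Finset.sum_range_succ, Finset.sum_range_succ, hEp]
    omega
  have hex : ∃ q, p < q ∧ ∑ i ∈ Finset.range (q + 1), e i = ∑ i ∈ Finset.range (q + 1), d i := by
    have hn : n ≠ p + 1 := fun h => by rw [h] at hsum; omega
    refine ⟨n - 1, by omega, ?_⟩
    rw [show n - 1 + 1 = n by omega, hsum]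
  -- The first index after p at which the partial sums agree again. They are strictly smaller in
  -- between, which forces d q < e q.
  set q := Nat.find hex with hq
  obtain ⟨hpq, hEq⟩ : p < q ∧
      ∑ i ∈ Finset.range (q + 1), e i = ∑ i ∈ Finset.range (q + 1), d i := Nat.find_spec hex
  have hqn : q < n := by
    have hn : n ≠ p + 1 := fun h => by rw [h] at hsum; omega
    have : q ≤ n - 1 := Nat.find_min' hex ⟨by omega, by
      rw [show n - 1 + 1 = n by omega, hsum]⟩
    omega
  have hmid : ∀ k, p < k → k ≤ q →
      ∑ i ∈ Finset.range k, e i < ∑ i ∈ Finset.range k, d i := by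
    intro k hk1 hk2
    rcases Nat.eq_or_lt_of_le hk1 with h | h
    · rw [← h]; exact hEp1
    · have := Nat.find_min hex (m := k - 1) (by omega)
      push Not at this
      have := this (by omega)
      rw [show k - 1 + 1 = k by omega] at this
      exact lt_of_le_of_ne (hle k) this
  have hdq : d q < e q := by
    have := hmid q hpq le_rfl
    rw [Finset.sum_range_succ, Finset.sum_range_succ] at hEq
    omega
  have hq1 : e (q + 1) ≤ d (q + 1) := by
    have := hle (q + 1 + 1)
    rw [Finset.sum_range_succ, Finset.sum_range_succ _ (q + 1), hEq] at this
    omega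
  have hall : ∀ S : Finset ℕ, ∑ i ∈ S, e i ≤ ∑ i ∈ Finset.range S.card, d i := fun S =>
    (sum_le_sum_range_of_antitone he S).trans (hle _)
  have hswap : ∀ (S : Finset ℕ) (i j : ℕ), j ∈ S → i ∉ S → e j < e i →
      ∑ i ∈ S, e i + 1 ≤ ∑ i ∈ Finset.range S.card, d i := by
    intro S i j hj hi hij
    have h1 := hall (insert i (S.erase j))
    have hi' : i ∉ S.erase j := fun h => hi (Finset.mem_of_mem_erase h)
    rw [Finset.sum_insert hi', Finset.card_insert_of_notMem hi', Finset.card_erase_of_mem hj,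
      Nat.sub_add_cancel (Finset.card_pos.2 ⟨j, hj⟩)] at h1
    have h2 := Finset.sum_erase_add S e hj
    omega
  refine ⟨p, q, hpq, hqn, hdq, fun S => ?_⟩
  by_cases hpS : p ∈ S
  · by_cases hqS : q ∈ S
    · simpa [hpS, hqS] using hall S
    · simp only [hpS, hqS, if_true, if_false, add_zero]
      -- The only critical case, p in S and q not: one unit of slack is needed. If |S| ≤ p, S misses
      -- some i < p with e p < e i; if p < |S| ≤ q, the prefix inequality is strict; otherwise S
      -- contains some j > q with e j < e q. In the outer cases a swap gives the slack.
      rcases le_or_gt S.card p with hk | hk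
      · obtain ⟨i, hi, hiS⟩ : ∃ i ∈ Finset.range p, i ∉ S := by
          by_contra! h
          have := Finset.card_le_card (Finset.insert_subset hpS (h : Finset.range p ⊆ S))
          rw [Finset.card_insert_of_notMem (by simp), Finset.card_range] at this
          omega
        have hi := Finset.mem_range.1 hi
        refine hswap S i p hpS hiS ?_
        rw [hpmin i hi]
        exact hpd.trans_le (hd hi.le)
      · rcases le_or_gt S.card q with hk' | hk'
        · exact (Nat.succ_le_of_lt
            ((sum_le_sum_range_of_antitone he S).trans_lt (hmid _ hk hk')))
        · obtain ⟨j, hj, hjq⟩ : ∃ j ∈ S, q < j := by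
            by_contra! h
            have : S ⊆ Finset.range q := fun x hx => Finset.mem_range.2
              (lt_of_le_of_ne (h x hx) (fun hxq => hqS (hxq ▸ hx)))
            have := Finset.card_le_card this
            rw [Finset.card_range] at this
            omega
          refine hswap S q j hj hqS ?_
          exact (he hjq).trans_lt (hq1.trans_lt ((hd (Nat.le_succ q)).trans_lt hdq))
  · simpa [hpS] using (hall S).trans (Nat.le_add_right _ _)

variable {n : ℕ}

/-- Extension of a finite sequence by zeros. -/
def extendZero (d : Fin n → ℕ) (i : ℕ) : ℕ :=
  if h : i < n then d ⟨i, h⟩ else 0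

@[simp]
theorem extendZero_val (d : Fin n → ℕ) (i : Fin n) : extendZero d i = d i := by
  simp [extendZero]

theorem antitone_extendZero {d : Fin n → ℕ} (hd : Antitone d) : Antitone (extendZero d) := by
  intro i j hij
  unfold extendZero
  by_cases hj : j < n
  · rw [dif_pos hj, dif_pos (hij.trans_lt hj)]
    exact hd hij
  · rw [dif_neg hj]; exact Nat.zero_le _

theorem sum_eq_sum_map_extendZero (d : Fin n → ℕ) (S : Finset (Fin n)) :
    ∑ i ∈ S, d i = ∑ j ∈ S.map Fin.valEmbedding, extendZero d j := by
  simp [Finset.sum_map]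

/-- The sum of the first `k` entries. -/
def prefixSum (d : Fin n → ℕ) (k : ℕ) : ℕ := ∑ i ∈ Finset.range k, extendZero d i

theorem sum_le_prefixSum {d : Fin n → ℕ} (hd : Antitone d) (S : Finset (Fin n)) :
    ∑ i ∈ S, d i ≤ prefixSum d S.card := by
  rw [sum_eq_sum_map_extendZero]
  have := sum_le_sum_range_of_antitone (antitone_extendZero hd) (S.map Fin.valEmbedding)
  rwa [Finset.card_map] at this

theorem sum_Iic_eq_prefixSum (d : Fin n → ℕ) (k : Fin n) :
    ∑ i ∈ Finset.Iic k, d i = prefixSum d (k + 1) := by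
  rw [sum_eq_sum_map_extendZero, Fin.map_valEmbedding_Iic, prefixSum]
  congr 1
  ext x
  simp

theorem sum_univ_eq_prefixSum (d : Fin n → ℕ) {k : ℕ} (hk : n ≤ k) :
    ∑ i, d i = prefixSum d k := by
  rw [sum_eq_sum_map_extendZero, prefixSum]
  refine Finset.sum_subset (fun x hx => ?_) (fun x _ hx => ?_)
  · obtain ⟨i, -, rfl⟩ := Finset.mem_map.1 hx
    exact Finset.mem_range.2 (i.2.trans_le hk)
  · rw [extendZero, dif_neg fun h => hx (Finset.mem_map.2 ⟨⟨x, h⟩, Finset.mem_univ _, rfl⟩)]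

theorem Majorizes.prefixSum_le {d d' : Fin n → ℕ} (h : Majorizes d' d) (k : ℕ) :
    prefixSum d k ≤ prefixSum d' k := by
  rcases le_or_gt n k with hk | hk
  · rw [← sum_univ_eq_prefixSum d hk, ← sum_univ_eq_prefixSum d' hk, h.2]
  · cases k with
    | zero => simp [prefixSum]
    | succ k =>
      have := h.1 ⟨k, by omega⟩
      rwa [sum_Iic_eq_prefixSum, sum_Iic_eq_prefixSum] at this

theorem eq_of_prefixSum_eq {d d' : Fin n → ℕ} (h : ∀ k, prefixSum d k = prefixSum d' k) :
    d = d' := by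
  funext i
  have h1 := h i
  have h2 := h (i + 1)
  rw [prefixSum, prefixSum, Finset.sum_range_succ, Finset.sum_range_succ] at h2
  rw [prefixSum, prefixSum] at h1
  simpa [h1] using h2

end Sequences

/-! ### Recognizing the breadth-first tree. -/

section BFS

variable {n : ℕ} {d : Fin n → ℕ} {par : Fin n → Fin n}

/-- Since `par` is monotone and I is an initial segment, the children of I are exactly the labels
from 1 up to their total number. Label 0 is the root. -/
theorem val_le_sum_numChildren_iff
    (hmono : ∀ i j : Fin n, (i : ℕ) ≠ 0 → (j : ℕ) ≠ 0 → i ≤ j → par i ≤ par j)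
    (hcard : ∀ i, (Finset.univ.filter fun j : Fin n => (j : ℕ) ≠ 0 ∧ par j = i).card =
      numChildren d i)
    {I : Finset (Fin n)} (hI : ∀ i ∈ I, ∀ j ≤ i, j ∈ I) {j : Fin n} (hj : (j : ℕ) ≠ 0) :
    (j : ℕ) ≤ ∑ l ∈ I, numChildren d l ↔ par j ∈ I := by
  have hsum : ∑ l ∈ I, numChildren d l =
      (Finset.univ.filter fun j : Fin n => (j : ℕ) ≠ 0 ∧ par j ∈ I).card := by
    rw [Finset.card_eq_sum_card_fiberwise (f := par) (t := I)
      (fun x hx => (Finset.mem_filter.1 hx).2.2)]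
    refine Finset.sum_congr rfl fun i hi => ?_
    rw [← hcard i, Finset.filter_filter]
    congr 1
    ext x
    simp only [Finset.mem_filter, Finset.mem_univ, true_and]
    constructor
    · rintro ⟨h, rfl⟩; exact ⟨⟨h, hi⟩, rfl⟩
    · rintro ⟨⟨h, -⟩, h'⟩; exact ⟨h, h'⟩
  have hcardv : ∀ S : Finset (Fin n), (S.map Fin.valEmbedding).card = S.card := fun S =>
    Finset.card_map _
  rw [hsum, ← hcardv]
  constructor
  · intro h
    by_contra hn
    have hsub : ((Finset.univ.filter fun j : Fin n => (j : ℕ) ≠ 0 ∧ par j ∈ I).map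
        Fin.valEmbedding) ⊆ Finset.Ioo 0 (j : ℕ) := by
      intro x hx
      obtain ⟨i, hi, rfl⟩ := Finset.mem_map.1 hx
      obtain ⟨-, hi0, hiI⟩ := Finset.mem_filter.1 hi
      refine Finset.mem_Ioo.2 ⟨Nat.pos_of_ne_zero hi0, ?_⟩
      by_contra hji
      exact hn (hI _ hiI _ (hmono j i hj hi0 (not_lt.1 hji)))
    have := Finset.card_le_card hsub
    rw [Nat.card_Ioo] at this
    omega
  · intro h
    have hsub : Finset.Ioc 0 (j : ℕ) ⊆
        (Finset.univ.filter fun j : Fin n => (j : ℕ) ≠ 0 ∧ par j ∈ I).map Fin.valEmbedding := by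
      intro x hx
      obtain ⟨hx0, hxj⟩ := Finset.mem_Ioc.1 hx
      have hxn : x < n := hxj.trans_lt j.2
      refine Finset.mem_map.2 ⟨⟨x, hxn⟩, ?_, rfl⟩
      refine Finset.mem_filter.2 ⟨Finset.mem_univ _, hx0.ne', ?_⟩
      exact hI _ h _ (hmono ⟨x, hxn⟩ j hx0.ne' hj hxj)
    have := Finset.card_le_card hsub
    rwa [Nat.card_Ioc, Nat.sub_zero] at this

/-- The children of i are those of `Iic i` that are not children of `Iio i`. -/
theorem isBFSChild_iff
    (hmono : ∀ i j : Fin n, (i : ℕ) ≠ 0 → (j : ℕ) ≠ 0 → i ≤ j → par i ≤ par j)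
    (hcard : ∀ i, (Finset.univ.filter fun j : Fin n => (j : ℕ) ≠ 0 ∧ par j = i).card =
      numChildren d i) (i j : Fin n) :
    IsBFSChild d i j ↔ (j : ℕ) ≠ 0 ∧ par j = i := by
  unfold IsBFSChild
  by_cases hj : (j : ℕ) = 0
  · simp [hj]
  · have h1 := val_le_sum_numChildren_iff hmono hcard (I := Finset.Iio i)
      (fun a ha b hb => Finset.mem_Iio.2 (hb.trans_lt (Finset.mem_Iio.1 ha))) hj
    have h2 := val_le_sum_numChildren_iff hmono hcard (I := Finset.Iic i)
      (fun a ha b hb => Finset.mem_Iic.2 (hb.trans (Finset.mem_Iic.1 ha))) hj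
    rw [Finset.mem_Iio] at h1
    rw [Finset.mem_Iic] at h2
    constructor
    · rintro ⟨h3, h4⟩
      refine ⟨hj, le_antisymm (h2.1 (by omega)) (not_lt.1 fun h => ?_)⟩
      have := h1.2 h
      omega
    · rintro ⟨-, h3⟩
      have h4 := h2.2 h3.le
      have h5 : ¬((j : ℕ) ≤ ∑ l ∈ Finset.Iio i, numChildren d l) := fun h =>
        absurd (h1.1 h) (by simp [h3])
      omega

theorem IsParentMap.vdeg_eq {V : Type*} [Fintype V] [DecidableEq V] {T : SimpleGraph V} {r : V}
    {p : V → V} (hp : IsParentMap T r p) (v : V) :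
    vdeg T v = (Finset.univ.filter fun w => w ≠ r ∧ p w = v).card + if v = r then 0 else 1 := by
  have hchild : ∀ w, w ≠ r → p w = v → T.Adj v w := by
    rintro w hw rfl
    exact (hp.adj w hw).symm
  unfold vdeg
  by_cases hv : v = r
  · rw [if_pos hv, add_zero, ← Set.ncard_coe_finset]
    congr 1
    ext w
    simp only [SimpleGraph.mem_neighborSet, Finset.coe_filter, Finset.mem_univ, true_and,
      Set.mem_ofPred_eq]
    refine ⟨fun h => ?_, fun h => hchild w h.1 h.2⟩
    rcases hp.eq_of_adj v w h with h | h
    · exact absurd hv h.1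
    · exact h
  · have hnot : p v ∉ Finset.univ.filter fun w => w ≠ r ∧ p w = v := by
      intro h
      exact hp.iterate_parent_ne hv 1 (Finset.mem_filter.1 h).2.2
    rw [if_neg hv, ← Finset.card_insert_of_notMem hnot, ← Set.ncard_coe_finset]
    congr 1
    ext w
    simp only [SimpleGraph.mem_neighborSet, Finset.coe_insert, Finset.coe_filter,
      Finset.mem_univ, true_and, Set.mem_insert_iff, Set.mem_ofPred_eq]
    constructor
    · intro h
      rcases hp.eq_of_adj v w h with h | h
      · exact Or.inl h.2.symm
      · exact Or.inr h
    · rintro (rfl | h)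
      · exact hp.adj v hv
      · exact hchild w h.1 h.2

/-- A tree listed by a breadth-first key with degrees `d` is the breadth-first tree of `d`. -/
theorem comap_eq_bfsTree {T : SimpleGraph (Fin n)} {r : Fin n} {p : Fin n → Fin n}
    (hp : IsParentMap T r p) (σ : Equiv.Perm (Fin n)) (hr : ∀ i, σ i = r ↔ (i : ℕ) = 0)
    (hmono : ∀ i j : Fin n, (i : ℕ) ≠ 0 → (j : ℕ) ≠ 0 → i ≤ j →
      σ.symm (p (σ i)) ≤ σ.symm (p (σ j)))
    (hd : ∀ i, vdeg T (σ i) = d i) : T.comap σ = bfsTree d := by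
  have hcard : ∀ i, (Finset.univ.filter fun j : Fin n => (j : ℕ) ≠ 0 ∧
      σ.symm (p (σ j)) = i).card = numChildren d i := by
    intro i
    have h1 := hp.vdeg_eq (σ i)
    have h2 : (Finset.univ.filter fun w => w ≠ r ∧ p w = σ i).card =
        (Finset.univ.filter fun j : Fin n => (j : ℕ) ≠ 0 ∧ σ.symm (p (σ j)) = i).card := by
      refine (Finset.card_bij (fun j _ => σ j) ?_ (fun _ _ _ _ h => σ.injective h) ?_).symm
      · intro j hj
        simpa [hr, Equiv.symm_apply_eq] using hj
      · intro w hw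
        refine ⟨σ.symm w, ?_, by simp⟩
        have := hr (σ.symm w)
        rw [Equiv.apply_symm_apply] at this
        simpa [← this, Equiv.symm_apply_eq] using hw
    rw [hd, h2] at h1
    unfold numChildren
    by_cases hi : (i : ℕ) = 0
    · rw [if_pos ((hr i).2 hi)] at h1
      rw [if_pos hi]; omega
    · rw [if_neg (fun h => hi ((hr i).1 h))] at h1
      rw [if_neg hi]; omega
  ext i j
  rw [bfsTree, SimpleGraph.fromRel_adj, isBFSChild_iff hmono hcard, isBFSChild_iff hmono hcard,
    SimpleGraph.comap_adj, Equiv.symm_apply_eq, Equiv.symm_apply_eq, Ne, Ne, Ne, ← hr i,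
    ← hr j]
  constructor
  · intro h
    exact ⟨fun hij => h.ne (hij ▸ rfl), (hp.eq_of_adj _ _ h).symm⟩
  · rintro ⟨-, ⟨h1, h2⟩ | ⟨h1, h2⟩⟩
    · have := hp.adj _ h1
      rw [h2] at this
      exact this.symm
    · have := hp.adj _ h1
      rwa [h2] at this

end BFS

/-! ### Subtrees as connected vertex sets. -/

section Subtrees

variable {V : Type*} {G : SimpleGraph V}

theorem connectedOn_iff_induce_connected {S : Finset V} :
    ConnectedOn G S ↔ (G.induce (S : Set V)).Connected := by
  classical
  constructor
  · intro hS
    obtain ⟨a, ha⟩ := hS.1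
    rw [SimpleGraph.connected_iff_exists_forall_reachable]
    refine ⟨⟨a, ha⟩, ?_⟩
    by_contra! hcon
    obtain ⟨⟨b, hb⟩, hab⟩ := hcon
    obtain ⟨x, hx, y, hy, hyX, hxy⟩ := hS.2
      (S.filter fun v => ∃ h : v ∈ S, (G.induce (S : Set V)).Reachable ⟨a, ha⟩ ⟨v, h⟩)
      (Finset.filter_subset _ _) ⟨a, by simp [ha]⟩ (fun h => by
        rw [← h] at hb
        exact hab (Finset.mem_filter.1 hb).2.2)
    obtain ⟨hx', hr⟩ := (Finset.mem_filter.1 hx).2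
    refine hyX (Finset.mem_filter.2 ⟨hy, hy, hr.trans (SimpleGraph.Adj.reachable ?_)⟩)
    exact hxy
  · intro h
    have hne := h.nonempty
    refine ⟨⟨_, hne.some.2⟩, fun X hX ⟨a, ha⟩ hneS => ?_⟩
    obtain ⟨b, hb, hbX⟩ : ∃ b ∈ S, b ∉ X := by
      by_contra! hc
      exact hneS (Finset.Subset.antisymm hX hc)
    obtain ⟨p⟩ := h.preconnected ⟨a, hX ha⟩ ⟨b, hb⟩
    obtain ⟨e, -, h1, h2⟩ := p.exists_boundary_dart {v | (v : V) ∈ X} ha hbX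
    exact ⟨_, h1, _, e.snd.2, h2, e.adj⟩

/-- In an acyclic graph, connected subgraphs are induced. -/
theorem SimpleGraph.IsAcyclic.subgraph_adj_iff (hG : G.IsAcyclic) {H : G.Subgraph}
    (hH : H.coe.Connected) {a b : V} : H.Adj a b ↔ G.Adj a b ∧ a ∈ H.verts ∧ b ∈ H.verts := by
  refine ⟨fun h => ⟨h.adj_sub, h.fst_mem, h.snd_mem⟩, fun ⟨hab, ha, hb⟩ => ?_⟩
  obtain ⟨q, hq, -⟩ := hH.exists_path_of_dist ⟨a, ha⟩ ⟨b, hb⟩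
  have h1 := (hG.subsingleton_path a b).elim ⟨_, hq.map (f := H.hom) H.hom_injective⟩
    (SimpleGraph.Path.singleton hab)
  have h2 := congrArg (fun p : G.Path a b => p.1.length) h1
  have h3 : q.length = 1 := (SimpleGraph.Walk.length_map H.hom q).symm.trans (h2.trans (by simp))
  exact SimpleGraph.Walk.adj_of_length_eq_one h3

/-- A subtree of a forest is determined by its vertex set, being induced, and every connected vertex
set induces a subtree. -/
theorem SimpleGraph.IsAcyclic.subtreeCount_eq [Fintype V] (hG : G.IsAcyclic) :
    subtreeCount G = connCount G ∅ := by
  classical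
  unfold subtreeCount connCount
  rw [← Set.ncard_coe_finset]
  refine Set.ncard_congr (fun H _ => H.verts.toFinset) ?_ ?_ ?_
  · intro H hH
    have hH : H.coe.IsTree := hH
    refine Finset.mem_coe.2 (mem_connSets.2 ⟨?_, Finset.empty_subset _⟩)
    rw [connectedOn_iff_induce_connected]
    have hc := hH.connected
    rw [Set.coe_toFinset]
    refine hc.mono ?_
    intro a b h
    exact h.adj_sub
  · intro H K hH hK h
    have hH : H.coe.IsTree := hH
    have hK : K.coe.IsTree := hK
    have hv : H.verts = K.verts := Set.toFinset_inj.1 h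
    refine SimpleGraph.Subgraph.ext hv ?_
    ext a b
    rw [hG.subgraph_adj_iff hH.connected, hG.subgraph_adj_iff hK.connected, hv]
  · intro S hS
    have hS := (mem_connSets.1 (Finset.mem_coe.1 hS)).1
    rw [connectedOn_iff_induce_connected] at hS
    refine ⟨(⊤ : G.Subgraph).induce (S : Set V), ?_, by simp⟩
    refine ⟨?_, hG.subgraph _⟩
    refine hS.mono ?_
    intro a b h
    exact ⟨a.2, b.2, h⟩

theorem connCount_comap_empty [Fintype V] (σ : Equiv.Perm V) :
    connCount (G.comap σ) ∅ = connCount G ∅ := by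
  classical
  refine Finset.card_bij (fun S _ => S.map σ.toEmbedding) ?_ ?_ ?_
  · intro S hS
    refine mem_connSets.2 ⟨?_, Finset.empty_subset _⟩
    obtain ⟨hne, hS⟩ := (mem_connSets.1 hS).1
    refine ⟨by simpa using hne, fun X hX hXne hXS => ?_⟩
    obtain ⟨a, ha, b, hb, hbX, hab⟩ := hS (X.map σ.symm.toEmbedding) (fun x hx => by
        obtain ⟨y, hy, rfl⟩ := Finset.mem_map.1 hx
        obtain ⟨z, hz, rfl⟩ := Finset.mem_map.1 (hX hy)
        simpa using hz) (by simpa using hXne) (fun h => hXS (by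
          rw [← h, Finset.map_map]; simp))
    refine ⟨σ a, ?_, σ b, by simpa using hb, ?_, hab⟩
    · obtain ⟨y, hy, rfl⟩ := Finset.mem_map.1 ha
      simpa using hy
    · intro h
      exact hbX (Finset.mem_map.2 ⟨σ b, h, by simp⟩)
  · intro S _ S' _ h
    exact Finset.map_injective _ h
  · intro S hS
    obtain ⟨hne, hS⟩ := (mem_connSets.1 hS).1
    refine ⟨S.map σ.symm.toEmbedding, mem_connSets.2 ⟨⟨by simpa using hne, ?_⟩,
      Finset.empty_subset _⟩, by rw [Finset.map_map]; simp⟩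
    intro X hX hXne hXS
    obtain ⟨a, ha, b, hb, hbX, hab⟩ := hS (X.map σ.toEmbedding) (fun x hx => by
        obtain ⟨y, hy, rfl⟩ := Finset.mem_map.1 hx
        obtain ⟨z, hz, rfl⟩ := Finset.mem_map.1 (hX hy)
        simpa using hz) (by simpa using hXne) (fun h => hXS (by
          rw [← h, Finset.map_map]; simp))
    obtain ⟨y, hy, rfl⟩ := Finset.mem_map.1 ha
    refine ⟨y, hy, σ.symm b, by simpa using hb, fun h => ?_, by simpa using hab⟩
    exact hbX (Finset.mem_map.2 ⟨σ.symm b, h, by simp⟩)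

end Subtrees

/-! ### Maximizers in the majorization class. -/

section Maximizers

variable {n : ℕ}

/-- The trees whose degree sequence is majorized by `d`. -/
def treeClass (d : Fin n → ℕ) : Set (SimpleGraph (Fin n)) :=
  {T | T.IsTree ∧ ∀ S : Finset (Fin n), ∑ v ∈ S, vdeg T v ≤ prefixSum d S.card}

theorem treesWithDegrees_subset_treeClass (d : Fin n → ℕ) :
    treesWithDegrees d ⊆ treeClass d := by
  rintro T ⟨hT, hd, e, he⟩
  refine ⟨hT, fun S => ?_⟩
  have h := sum_le_prefixSum hd (S.map e.symm.toEmbedding)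
  rw [Finset.card_map, Finset.sum_map] at h
  refine le_trans (le_of_eq (Finset.sum_congr rfl fun v _ => ?_)) h
  rw [← he]
  simp [vdeg]

theorem treeClass_mono {d d' : Fin n → ℕ} (h : Majorizes d' d) : treeClass d ⊆ treeClass d' :=
  fun _ hT => ⟨hT.1, fun S => (hT.2 S).trans (h.prefixSum_le _)⟩

theorem prefixSum_le_of_mem {d d' : Fin n → ℕ} {T : SimpleGraph (Fin n)}
    (h : T ∈ treesWithDegrees d) (h' : T ∈ treesWithDegrees d') (k : ℕ) :
    prefixSum d k ≤ prefixSum d' k := by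
  have h1 := (treesWithDegrees_subset_treeClass d' h').2
  obtain ⟨-, -, e, he⟩ := h
  have key : ∀ S : Finset (Fin n), ∑ i ∈ S, d i ≤ prefixSum d' S.card := by
    intro S
    have := h1 (S.map e.toEmbedding)
    rw [Finset.card_map, Finset.sum_map] at this
    refine le_trans (le_of_eq (Finset.sum_congr rfl fun i _ => ?_)) this
    exact (he i).symm
  rcases le_or_gt n k with hk | hk
  · have := key Finset.univ
    rwa [Finset.card_univ, Fintype.card_fin, ← sum_univ_eq_prefixSum d' le_rfl,
      sum_univ_eq_prefixSum d hk, sum_univ_eq_prefixSum d' hk] at this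
  · cases k with
    | zero => simp [prefixSum]
    | succ k =>
      have := key (Finset.Iic ⟨k, by omega⟩)
      rw [sum_Iic_eq_prefixSum] at this
      simpa using this

theorem eq_of_mem_treesWithDegrees {d d' : Fin n → ℕ} {T : SimpleGraph (Fin n)}
    (h : T ∈ treesWithDegrees d) (h' : T ∈ treesWithDegrees d') : d = d' :=
  eq_of_prefixSum_eq fun k => le_antisymm (prefixSum_le_of_mem h h' k) (prefixSum_le_of_mem h' h k)

theorem sum_eq_of_mem_treesWithDegrees {d : Fin n → ℕ} {T : SimpleGraph (Fin n)}
    (h : T ∈ treesWithDegrees d) : ∑ i, d i = 2 * (n - 1) := by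
  obtain ⟨hT, -, e, he⟩ := h
  have := hT.sum_vdeg
  rw [Fintype.card_fin, ← Equiv.sum_comp e] at this
  rw [← this]
  exact Finset.sum_congr rfl fun i _ => (he i).symm

theorem sum_vdeg_move {T T' : SimpleGraph (Fin n)} {u v : Fin n}
    (h : ∀ x, vdeg T' x + (if x = v then 1 else 0) = vdeg T x + (if x = u then 1 else 0))
    (S : Finset (Fin n)) :
    ∑ x ∈ S, vdeg T' x + (if v ∈ S then 1 else 0) =
      ∑ x ∈ S, vdeg T x + (if u ∈ S then 1 else 0) := by
  have := Finset.sum_congr (rfl : S = S) (fun x _ => h x)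
  simpa [Finset.sum_add_distrib, Finset.sum_ite_eq'] using this

/-- In a maximizer, vertices lying in more subtrees have larger degree. -/
theorem vdeg_le_of_connCount_le (hn : 2 ≤ n) {d : Fin n → ℕ} {T : SimpleGraph (Fin n)}
    (hT : T ∈ treeClass d) (hmax : ∀ T' ∈ treeClass d, connCount T' ∅ ≤ connCount T ∅)
    {u v : Fin n} (hf : connCount T {v} ≤ connCount T {u}) : vdeg T v ≤ vdeg T u := by
  by_contra! hlt
  have : Nontrivial (Fin n) := Fin.nontrivial_iff_two_le.2 hn
  have hpos := hT.1.connected.vdeg_pos u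
  have huv : u ≠ v := fun h => by rw [h] at hlt; exact lt_irrefl _ hlt
  -- Since u has degree at least 1 and v a larger one, v has a branch not containing u.
  obtain ⟨w, hw, hr⟩ := hT.1.exists_adj_reachable (u := u) (v := v) (by omega)
  obtain ⟨T', hT', hdeg, hc⟩ := hT.1.exists_move huv hw hr hf
  refine absurd (hmax T' ⟨hT', fun S => ?_⟩) (not_le.2 hc)
  have h1 := sum_vdeg_move hdeg S
  have h2 := hT.2 S
  by_cases huS : u ∈ S
  · by_cases hvS : v ∈ S
    · simp only [huS, hvS, if_true] at h1; omega
    · simp only [huS, hvS, if_true, if_false] at h1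
      -- Replacing u by v in S raises the degree sum and keeps the size, so the bound for S has a
      -- unit to spare.
      have hvS' : v ∉ S.erase u := fun h => hvS (Finset.mem_of_mem_erase h)
      have h3 := hT.2 (insert v (S.erase u))
      rw [Finset.sum_insert hvS', Finset.card_insert_of_notMem hvS', Finset.card_erase_of_mem huS,
        Nat.sub_add_cancel (Finset.card_pos.2 ⟨u, huS⟩)] at h3
      have h4 := Finset.sum_erase_add S (vdeg T) huS
      omega
  · simp only [huS, if_false] at h1
    omega

/-- A maximizer of the number of subtrees has extremal degrees along any listing of its vertices
by the number of subtrees containing them. -/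
theorem vdeg_eq_of_maximal (hn : 2 ≤ n) {d : Fin n → ℕ} (hd : IsTreeDegreeSequence d)
    {T : SimpleGraph (Fin n)} (hT : T ∈ treeClass d)
    (hmax : ∀ T' ∈ treeClass d, connCount T' ∅ ≤ connCount T ∅) (σ : Equiv.Perm (Fin n))
    (hσ : ∀ i j, i ≤ j → connCount T {σ j} ≤ connCount T {σ i}) (i : Fin n) :
    vdeg T (σ i) = d i := by
  obtain ⟨T₀, hT₀⟩ := hd
  have : Nontrivial (Fin n) := Fin.nontrivial_iff_two_le.2 hn
  have hdpos : ∀ i, 0 < d i := by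
    intro i
    obtain ⟨h0, -, e, he⟩ := hT₀
    rw [← he]
    exact h0.connected.vdeg_pos (e i)
  set e : Fin n → ℕ := fun i => vdeg T (σ i) with he
  have heanti : Antitone e := fun i j hij => vdeg_le_of_connCount_le hn hT hmax (hσ i j hij)
  have hesum : ∑ i, e i = ∑ i, d i := by
    rw [sum_eq_of_mem_treesWithDegrees hT₀, he, Equiv.sum_comp σ (vdeg T), hT.1.sum_vdeg,
      Fintype.card_fin]
  by_contra hne
  obtain ⟨p, q, hpq, hqn, hdq, hS⟩ := exists_transfer (e := extendZero e) (d := extendZero d)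
    (antitone_extendZero heanti) (antitone_extendZero hT₀.2.1) (n := n) (fun k => by
      rcases le_or_gt n k with hk | hk
      · exact (sum_univ_eq_prefixSum e hk ▸ sum_univ_eq_prefixSum d hk ▸ hesum).le
      · cases k with
        | zero => simp
        | succ k =>
          have := hT.2 ((Finset.Iic (⟨k, by omega⟩ : Fin n)).map σ.toEmbedding)
          rw [Finset.card_map, Finset.sum_map] at this
          have h2 := sum_Iic_eq_prefixSum e ⟨k, by omega⟩
          rw [prefixSum] at h2
          rw [← h2]
          simpa [he, prefixSum] using this)
    ((sum_univ_eq_prefixSum e le_rfl).symm.trans (hesum.trans (sum_univ_eq_prefixSum d le_rfl)))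
    ⟨i, i.2, by simpa using hne⟩
  have hpn := hpq.trans hqn
  set P : Fin n := ⟨p, hpn⟩ with hP
  set Q : Fin n := ⟨q, hqn⟩ with hQ
  have hdQ : d Q < e Q := by simpa [extendZero, hqn] using hdq
  have hPQ : P ≠ Q := fun h => hpq.ne (congrArg Fin.val h)
  -- The transfer is realized by moving a branch from σ Q to σ P; one exists because 1 ≤ d Q < e Q.
  obtain ⟨w, hw, hr⟩ := hT.1.exists_adj_reachable (u := σ P) (v := σ Q) (by
    have := hdpos Q
    simp only [he] at hdQ
    omega)
  obtain ⟨T', hT', hdeg, hc⟩ := hT.1.exists_move (fun h => hPQ (σ.injective h)) hw hr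
    (hσ P Q (show P ≤ Q from hpq.le))
  refine absurd (hmax T' ⟨hT', fun S => ?_⟩) (not_le.2 hc)
  have h1 := sum_vdeg_move hdeg S
  have h2 := hS ((S.map σ.symm.toEmbedding).map Fin.valEmbedding)
  rw [← sum_eq_sum_map_extendZero, Finset.card_map, Finset.card_map, Finset.sum_map] at h2
  have hmem : ∀ X : Fin n, (X : ℕ) ∈ (S.map σ.symm.toEmbedding).map Fin.valEmbedding ↔
      σ X ∈ S := by
    intro X
    constructor
    · intro h
      obtain ⟨y, hy, hyX⟩ := Finset.mem_map.1 h
      obtain rfl : y = X := Fin.ext hyX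
      obtain ⟨z, hz, rfl⟩ := Finset.mem_map.1 hy
      simpa using hz
    · intro h
      exact Finset.mem_map.2 ⟨X, Finset.mem_map.2 ⟨σ X, h, by simp⟩, rfl⟩
  have hmP := hmem P
  have hmQ := hmem Q
  simp only [hP, hQ] at hmP hmQ
  simp only [hmP, hmQ, he, Equiv.coe_toEmbedding, Equiv.apply_symm_apply] at h2
  simp only [prefixSum, hP, hQ] at h1 h2 ⊢
  omega

theorem exists_maximal_treeClass {d : Fin n → ℕ} (hd : IsTreeDegreeSequence d) :
    ∃ T ∈ treeClass d, ∀ T' ∈ treeClass d, connCount T' ∅ ≤ connCount T ∅ :=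
  Set.exists_max_image _ (fun T => connCount T ∅) (Set.toFinite _)
    (hd.mono (treesWithDegrees_subset_treeClass d))

/-- Sorting by the key lists the vertices in breadth-first order and with f nonincreasing at once:
the second property makes the degrees equal d, and the first then identifies the tree. -/
theorem bfsTree_of_maximal (hn : 2 ≤ n) {d : Fin n → ℕ} (hd : IsTreeDegreeSequence d)
    {T : SimpleGraph (Fin n)} (hT : T ∈ treeClass d)
    (hmax : ∀ T' ∈ treeClass d, connCount T' ∅ ≤ connCount T ∅) :
    T ∈ treesWithDegrees d ∧ subtreeCount (bfsTree d) = connCount T ∅ := by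
  obtain ⟨r, p, hp, K, hinj, hKr, hKp, hKmono, hKf⟩ := exists_bfs_key hn hT.1
    (fun T' hT' hdeg => hmax T' ⟨hT', fun S => by simpa only [hdeg] using hT.2 S⟩)
  have : NeZero n := ⟨by omega⟩
  set σ := Tuple.sort K with hσ
  have hmono : Monotone (K ∘ σ) := Tuple.monotone_sort K
  have hle : ∀ u v, K u ≤ K v ↔ σ.symm u ≤ σ.symm v := by
    have hs : StrictMono (K ∘ σ) := hmono.strictMono_of_injective (hinj.comp σ.injective)
    intro u v
    rw [← hs.le_iff_le]
    simp
  have hr : σ 0 = r := by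
    refine hinj (le_antisymm ?_ (hKr _))
    rw [hle]
    simp
  have hr' : ∀ i, σ i = r ↔ (i : ℕ) = 0 := by
    intro i
    rw [← hr, σ.injective.eq_iff, Fin.ext_iff]
    rfl
  have hdeg := vdeg_eq_of_maximal hn hd hT hmax σ (fun i j hij => hKf _ _ (hmono hij))
  have hbfs := comap_eq_bfsTree hp σ hr' (fun i j hi hj hij => (hle _ _).1
    (hKmono _ _ (fun h => hi ((hr' i).1 h)) (fun h => hj ((hr' j).1 h)) (hmono hij))) hdeg
  refine ⟨⟨hT.1, hd.some_mem.2.1, σ, hdeg⟩, ?_⟩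
  have hac : (bfsTree d).IsAcyclic := by
    rw [← hbfs]
    exact SimpleGraph.IsAcyclic.of_comap σ.toEmbedding hT.1.isAcyclic
  rw [hac.subtreeCount_eq, ← hbfs, connCount_comap_empty]

end Maximizers

/-! ### Comparison of the two maxima. -/

theorem theorem2p4 (n : ℕ) (hn : 3 ≤ n) (π π₁ : Fin n → ℕ)
    (hπ : IsTreeDegreeSequence π) (hπ₁ : IsTreeDegreeSequence π₁)
    (hne : π ≠ π₁) (hmaj : Majorizes π₁ π) :
    subtreeCount (bfsTree π) < subtreeCount (bfsTree π₁) ∧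
      ∃ m m₁ : ℕ, IsGreatest (subtreeCount '' treesWithDegrees π) m ∧
        IsGreatest (subtreeCount '' treesWithDegrees π₁) m₁ ∧ m < m₁ := by
  obtain ⟨T, hT, hmax⟩ := exists_maximal_treeClass hπ
  obtain ⟨T₁, hT₁, hmax₁⟩ := exists_maximal_treeClass hπ₁
  obtain ⟨hTπ, hTφ⟩ := bfsTree_of_maximal (by omega) hπ hT hmax
  obtain ⟨hTπ₁, hTφ₁⟩ := bfsTree_of_maximal (by omega) hπ₁ hT₁ hmax₁
  have hlt : connCount T ∅ < connCount T₁ ∅ := by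
    have hT' : T ∈ treeClass π₁ := treeClass_mono hmaj hT
    -- Equality would make T a maximizer in the larger class, so T would have degree sequence π₁ as
    -- well as π.
    refine lt_of_le_of_ne (hmax₁ T hT') fun h => hne ?_
    exact eq_of_mem_treesWithDegrees hTπ
      (bfsTree_of_maximal (by omega) hπ₁ hT' fun T' hT'' => h ▸ hmax₁ T' hT'').1
  have hgreatest : ∀ {d : Fin n → ℕ} {T : SimpleGraph (Fin n)}, T ∈ treesWithDegrees d →
      (∀ T' ∈ treeClass d, connCount T' ∅ ≤ connCount T ∅) →
      IsGreatest (subtreeCount '' treesWithDegrees d) (connCount T ∅) := by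
    intro d T hT hmax
    refine ⟨⟨T, hT, hT.1.isAcyclic.subtreeCount_eq⟩, ?_⟩
    rintro _ ⟨T', hT', rfl⟩
    rw [hT'.1.isAcyclic.subtreeCount_eq]
    exact hmax T' (treesWithDegrees_subset_treeClass d hT')
  exact ⟨by rw [hTφ, hTφ₁]; exact hlt, _, _, hgreatest hTπ hmax, hgreatest hTπ₁ hmax₁, hlt⟩
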